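/- There is exactly one classical solution $F$ on $[0,\infty)$ of the initial value problem $$F'''(x)+F(x)F''(x)=0\quad (x>0),\qquad F(0)=F'(0)=0,\quad F''(0)=1 .$$ Let $P(y)=\sum_{j=0}^{12}\frac{2}{5(j+2)(j+3)(j+4)}\,p_j\,y^j$, where $(p_0,\dots,p_{12})$ is $$\Big(-\tfrac{510}{10445149},\,-\tfrac{18523}{5934},\,-\tfrac{42998}{441819},\,\tfrac{113448}{81151},\,-\tfrac{65173}{22093},\,\tfrac{390101}{6016},\,-\tfrac{2326169}{9858},\,\tfrac{4134879}{7249},\,-\tfrac{1928001}{1960},\,\tfrac{20880183}{19117},\,-\tfrac{1572554}{2161},\,\tfrac{1546782}{5833},\,-\tfrac{1315241}{32239}\Big).$$ For real $a,b,c$ put $t(x)=\frac a2\left(x+\frac ba\right)^2$, $$I_0(t)=1-\sqrt{\pi t}\,e^{t}\,\mathrm{erfc}(\sqrt t),\qquad J_0(t)=1-\sqrt{2\pi t}\,e^{2t}\,\mathrm{erfc}(\sqrt{2t}),$$ $$q_0(t)=2c\sqrt t\,e^{-t}I_0(t)+c^2e^{-2t}\left(2J_0(t)-I_0(t)-I_0(t)^2\right),$$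 where $\mathrm{erfc}$ is the complementary error function, and $$F_0(x)=\begin{cases}\dfrac{x^2}{2}+x^4P\!\left(\dfrac25x\right), & x\in[0,\tfrac52],\\[2mm] ax+b+\sqrt{\dfrac{a}{2t(x)}}\;q_0(t(x)), & x>\tfrac52 .\end{cases}$$ Then there is a unique triple $(a,b,c)\in\mathbb R^3$ with $$\sqrt{\left(a-\tfrac{3221}{1946}\right)^2+\tfrac14\left(b+\tfrac{2763}{1765}\right)^2+\tfrac14\left(c-\tfrac{377}{1613}\right)^2}\le 5\times10^{-5}$$ such that $E=F-F_0$ satisfies $$\|E''\|_\infty\le 3.5\times10^{-6},\qquad \|E'\|_\infty\le 4.5\times10^{-6},\qquad \|E\|_\infty\le 4\times10^{-6}\qquad\text{on }[0,\tfrac52],$$ and, for all $x\ge\frac52$ (at $x=\frac52$ with $E,E',E''$ replaced by their limits from the right), with $t=t(x)$, $$|E(x)|\le 1.69\times10^{-5}\,t^{-2}e^{-3t},\quad |E'(x)|\le 9.20\times10^{-5}\,t^{-3/2}e^{-3t},\quad |E''(x)|\le 5.02\times10^{-4}\,t^{-1}e^{-3t}.$$ Moreover, for this triple, $a=\lim_{x\to\infty}F'(x)$,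 and the Blasius problem $$f'''(x)+f(x)f''(x)=0\quad (x>0),\qquad f(0)=f'(0)=0,\qquad \lim_{x\to\infty}f'(x)=1$$ has exactly one classical solution on $[0,\infty)$, namely $f(x)=a^{-1/2}F(a^{-1/2}x)$; its wall stress is $f''(0)=a^{-3/2}$, and $|f''(0)-0.469600|\le 0.000022$. -/

import Mathlib

open Set Filter Topology MeasureTheory

noncomputable section

/-- `F` is a classical solution on `[0, ∞)` of `F''' + F F'' = 0` with
`F 0 = F' 0 = 0` and `F'' 0 = 1`. All derivatives are taken within `[0, ∞)`, i.e. they are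
one-sided at `0`, and the values of `F` at negative arguments play no role. -/
structure IsInitialValueSolution (F : ℝ → ℝ) : Prop where
  contDiffOn : ContDiffOn ℝ 3 F (Ici 0)
  ode : ∀ x ∈ Ioi (0 : ℝ),
    iteratedDerivWithin 3 F (Ici 0) x + F x * iteratedDerivWithin 2 F (Ici 0) x = 0
  value_zero : F 0 = 0
  deriv_zero : derivWithin F (Ici 0) 0 = 0
  deriv_two_zero : iteratedDerivWithin 2 F (Ici 0) 0 = 1

/-- `f` is a classical solution on `[0, ∞)` of the Blasius boundary value problem
`f''' + f f'' = 0`, `f 0 = f' 0 = 0`, `f' x → 1` as `x → ∞`. -/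
structure IsBlasiusSolution (f : ℝ → ℝ) : Prop where
  contDiffOn : ContDiffOn ℝ 3 f (Ici 0)
  ode : ∀ x ∈ Ioi (0 : ℝ),
    iteratedDerivWithin 3 f (Ici 0) x + f x * iteratedDerivWithin 2 f (Ici 0) x = 0
  value_zero : f 0 = 0
  deriv_zero : derivWithin f (Ici 0) 0 = 0
  deriv_tendsto : Tendsto (fun x => derivWithin f (Ici 0) x) atTop (𝓝 1)

/-- The complementary error function. -/
def erfc (z : ℝ) : ℝ := 2 / √Real.pi * ∫ s in Ioi z, Real.exp (-s ^ 2)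

/-- The coefficients `p_0, …, p_12`. -/
def pCoeff : Fin 13 → ℝ :=
  ![-510 / 10445149, -18523 / 5934, -42998 / 441819, 113448 / 81151, -65173 / 22093,
    390101 / 6016, -2326169 / 9858, 4134879 / 7249, -1928001 / 1960, 20880183 / 19117,
    -1572554 / 2161, 1546782 / 5833, -1315241 / 32239]

/-- The polynomial `P` of degree twelve. -/
def polyP (y : ℝ) : ℝ :=
  ∑ j : Fin 13, 2 / (5 * ((j : ℝ) + 2) * ((j : ℝ) + 3) * ((j : ℝ) + 4)) * pCoeff j * y ^ (j : ℕ)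

/-- The change of variable `t(x) = (a / 2) (x + b / a)²`. -/
def tVar (a b x : ℝ) : ℝ := a / 2 * (x + b / a) ^ 2

def I₀ (t : ℝ) : ℝ := 1 - √(Real.pi * t) * Real.exp t * erfc √t

def J₀ (t : ℝ) : ℝ := 1 - √(2 * Real.pi * t) * Real.exp (2 * t) * erfc √(2 * t)

def q₀ (c t : ℝ) : ℝ :=
  2 * c * √t * Real.exp (-t) * I₀ t
    + c ^ 2 * Real.exp (-2 * t) * (2 * J₀ t - I₀ t - I₀ t ^ 2)

/-- The expression that defines the approximation on `[0, 5/2]`. -/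
def F₀near (x : ℝ) : ℝ := x ^ 2 / 2 + x ^ 4 * polyP (2 / 5 * x)

/-- The expression that defines the approximation to the right of `5/2`. -/
def F₀far (a b c x : ℝ) : ℝ := a * x + b + √(a / (2 * tVar a b x)) * q₀ c (tVar a b x)

/-- The approximate solution; it need not be continuous at `5/2`. -/
def F₀ (a b c x : ℝ) : ℝ := if x ≤ 5 / 2 then F₀near x else F₀far a b c x

/-- The set `𝒮` of admissible parameters `(a, b, c)`. -/
def paramSet : Set (ℝ × ℝ × ℝ) :=
  {p | √((p.1 - 3221 / 1946) ^ 2 + 1 / 4 * (p.2.1 - (-2763 / 1765)) ^ 2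
      + 1 / 4 * (p.2.2 - 377 / 1613) ^ 2) ≤ 5 * 10 ^ (-5 : ℤ)}

/-- The error bounds for `E = F - F₀` and its first two derivatives. On `[0, 5/2]` the
derivatives are taken within this interval. On `[5/2, ∞)` they are taken within `[5/2, ∞)`, for
the right-hand expression of `F₀`: for `x > 5/2` this is `E`, and at `x = 5/2` it is the limit of
`E` and of its derivatives from the right. -/
structure ErrorBounds (F : ℝ → ℝ) (a b c : ℝ) : Prop where
  near_zero : ∀ x ∈ Icc (0 : ℝ) (5 / 2), |F x - F₀ a b c x| ≤ 4 * 10 ^ (-6 : ℤ)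
  near_one : ∀ x ∈ Icc (0 : ℝ) (5 / 2),
    |derivWithin (fun y => F y - F₀ a b c y) (Icc 0 (5 / 2)) x| ≤ 4.5 * 10 ^ (-6 : ℤ)
  near_two : ∀ x ∈ Icc (0 : ℝ) (5 / 2),
    |iteratedDerivWithin 2 (fun y => F y - F₀ a b c y) (Icc 0 (5 / 2)) x| ≤ 3.5 * 10 ^ (-6 : ℤ)
  far_zero : ∀ x ∈ Ici (5 / 2 : ℝ),
    |F x - F₀far a b c x|
      ≤ 1.69 * 10 ^ (-5 : ℤ) * tVar a b x ^ (-2 : ℝ) * Real.exp (-3 * tVar a b x)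
  far_one : ∀ x ∈ Ici (5 / 2 : ℝ),
    |derivWithin (fun y => F y - F₀far a b c y) (Ici (5 / 2)) x|
      ≤ 9.20 * 10 ^ (-5 : ℤ) * tVar a b x ^ (-3 / 2 : ℝ) * Real.exp (-3 * tVar a b x)
  far_two : ∀ x ∈ Ici (5 / 2 : ℝ),
    |iteratedDerivWithin 2 (fun y => F y - F₀far a b c y) (Ici (5 / 2)) x|
      ≤ 5.02 * 10 ^ (-4 : ℤ) * tVar a b x ^ (-1 : ℝ) * Real.exp (-3 * tVar a b x)

end

/-! Let S be the integral of F from 0. The equation integrates to F'' = exp(-S), so S solves S''' =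
exp(-S) with zero initial data, and S ≥ 0. On s ≥ 0 the map exp(-s) is 1-Lipschitz
(`abs_exp_neg_sub_exp_neg_le`), which makes the problem essentially linear. A contraction in a norm
weighted by exp(-2x) gives global existence (`exists_isFlow`). Grönwall's inequality with constant 1
(`abs_le_of_third_deriv`) gives uniqueness. Applied to an explicit polynomial that almost solves the
equation, it also encloses S, F, F', F'' on [0, 9/2] (`IsFlow.enclosure`). The polynomial
inequalities needed are reduced to integer arithmetic in the Chebyshev basis. Comparison with
`F₀near` settles [0, 5/2].

Beyond 9/2, F stays above F(9/2) > 5.88, so F'' decays at least exponentially. Hence F' → a, F - (a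
x + b) → 0 and F'' = C g exp(G), where g = exp(-(a x + b)²/(2a)) = exp(-t) and G → 0. The
corrections to the values at 9/2 are bounded by F''(9/2)/F(9/2)^k, which locates a, b and C
(`IsFlow.exists_asymptotic`); c is defined by C = c a √(2a).

For the far field, c times `tailTerm` is the threefold tail integral of C g, that is, G to first
order, and `F₀far` has second derivative C g (1 + c `tailTerm`). Therefore E'' = C g ((exp(G) - 1 -
G) + (G - c `tailTerm`)). Both summands are nonnegative and of order g², which explains the factor
exp(-3t) (`ParamRange.abs_u_sub_le`). Integrating twice from infinity bounds E' and E.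

The far bounds force the asymptote and the Gaussian amplitude of F, so they determine the triple
(`ErrorBounds.params_eq`). The Blasius problem reduces to the initial value problem by the scaling k
F(k x) (`IsFlow.eq_scale`). -/

/-! ### Polynomials with integer coefficients, given by lists -/

namespace IntPoly

/-- The value of the polynomial with the given list of coefficients. -/
noncomputable def eval : List ℤ → ℝ → ℝ
  | [], _ => 0
  | c :: l, x => c + x * eval l x

/-- Sum of two lists of coefficients. -/
def add : List ℤ → List ℤ → List ℤ
  | [], m => m
  | a :: l, [] => a :: l
  | a :: l, b :: m => (a + b) :: add l m

/-- Scalar multiple of a list of coefficients. -/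
def smul (k : ℤ) : List ℤ → List ℤ
  | [] => []
  | a :: l => (k * a) :: smul k l

/-- Coefficients of the product of two polynomials. -/
def mul : List ℤ → List ℤ → List ℤ
  | [], _ => []
  | a :: l, m => add (smul a m) (0 :: mul l m)

/-- Coefficients of `n p + x p'`, where `p` is given by the list. -/
def derivAux (n : ℤ) : List ℤ → List ℤ
  | [] => []
  | a :: l => (n * a) :: derivAux (n + 1) l

/-- Coefficients of the derivative. -/
def derivCoeff : List ℤ → List ℤ
  | [] => []
  | _ :: l => derivAux 1 l

theorem eval_add (l m : List ℤ) (x : ℝ) : eval (add l m) x = eval l x + eval m x := by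
  induction l generalizing m with
  | nil => simp [add, eval]
  | cons a l ih =>
    cases m with
    | nil => simp [add, eval]
    | cons b m => simp only [add, eval, ih, Int.cast_add]; ring

theorem eval_smul (k : ℤ) (l : List ℤ) (x : ℝ) : eval (smul k l) x = k * eval l x := by
  induction l with
  | nil => simp [smul, eval]
  | cons a l ih => simp only [smul, eval, ih, Int.cast_mul]; ring

theorem eval_mul (l m : List ℤ) (x : ℝ) : eval (mul l m) x = eval l x * eval m x := by
  induction l with
  | nil => simp [mul, eval]
  | cons a l ih => simp only [mul, eval, eval_add, eval_smul, ih, Int.cast_zero]; ring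

theorem eval_derivAux_succ (n : ℤ) (l : List ℤ) (x : ℝ) :
    eval (derivAux (n + 1) l) x = eval l x + eval (derivAux n l) x := by
  induction l generalizing n with
  | nil => simp [derivAux, eval]
  | cons a l ih =>
    simp only [derivAux, eval, ih (n + 1)]; push_cast; ring

theorem hasDerivAt_eval (l : List ℤ) (x : ℝ) : HasDerivAt (eval l) (eval (derivCoeff l) x) x := by
  induction l with
  | nil => simpa [eval, derivCoeff] using! hasDerivAt_const x (0 : ℝ)
  | cons a l ih =>
    have h := ((hasDerivAt_id x).mul ih).const_add (a : ℝ)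
    have e : eval (derivCoeff (a :: l)) x = 1 * eval l x + id x * eval (derivCoeff l) x := by
      cases l with
      | nil => simp [derivCoeff, derivAux, eval]
      | cons b l =>
        simp only [derivCoeff, derivAux, eval, id, eval_derivAux_succ 1]
        push_cast; ring
    rw [e]
    exact h

/-! ### Sup-norm bounds for polynomials via Chebyshev coefficients -/

/-- The combination of Chebyshev polynomials with the given coefficients, starting at index `n`. -/
noncomputable def chebEval (n : ℤ) : List ℤ → ℝ → ℝ
  | [], _ => 0
  | c :: l, y => c * (Polynomial.Chebyshev.T ℝ n).eval y + chebEval (n + 1) l y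

theorem chebEval_add (n : ℤ) (l m : List ℤ) (y : ℝ) :
    chebEval n (add l m) y = chebEval n l y + chebEval n m y := by
  induction l generalizing m n with
  | nil => simp [add, chebEval]
  | cons a l ih =>
    cases m with
    | nil => simp [add, chebEval]
    | cons b m => simp only [add, chebEval, ih, Int.cast_add]; ring

theorem chebEval_smul (n k : ℤ) (l : List ℤ) (y : ℝ) :
    chebEval n (smul k l) y = k * chebEval n l y := by
  induction l generalizing n with
  | nil => simp [smul, chebEval]
  | cons a l ih => simp only [smul, chebEval, ih, Int.cast_mul]; ring

theorem chebEval_shift (n : ℤ) (l : List ℤ) (y : ℝ) :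
    chebEval (n - 1) l y + chebEval (n + 1) l y = 2 * y * chebEval n l y := by
  induction l generalizing n with
  | nil => simp [chebEval]
  | cons a l ih =>
    have h := congrArg (Polynomial.eval y) (Polynomial.Chebyshev.T_add_one ℝ n)
    simp only [Polynomial.eval_sub, Polynomial.eval_mul, Polynomial.eval_ofNat,
      Polynomial.eval_X] at h
    have e := ih (n + 1)
    rw [show n + 1 - 1 = n by ring] at e
    simp only [chebEval, sub_add_cancel, h]
    linear_combination e

/-- Multiplication by `2 y` in the Chebyshev basis. -/
def chebMul (l : List ℤ) : List ℤ :=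
  match add l (0 :: 0 :: l) with
  | e :: f :: g :: r => f :: (e + g) :: r
  | _ => []

/-- The recurrence 2y Tₙ = Tₙ₋₁ + Tₙ₊₁ shifts the coefficients both ways. The downward shift of the
constant term lands on T₋₁ = T₁, so the entry at index -1 is folded into index 1. -/
theorem chebEval_chebMul {l : List ℤ} (hl : l ≠ []) (y : ℝ) :
    chebEval 0 (chebMul l) y = 2 * y * chebEval 0 l y := by
  rw [← chebEval_shift]
  have h : chebEval (0 - 1) l y + chebEval (0 + 1) l y
      = chebEval (-1) (add l (0 :: 0 :: l)) y := by
    rw [chebEval_add]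
    simp [chebEval]
  rw [h]
  obtain ⟨e, f, g, r, hr⟩ : ∃ e f g r, add l (0 :: 0 :: l) = e :: f :: g :: r := by
    match l, hl with
    | [a], _ => exact ⟨_, _, _, _, rfl⟩
    | [a, b], _ => exact ⟨_, _, _, _, rfl⟩
    | a :: b :: c :: l, _ => exact ⟨_, _, _, _, rfl⟩
  simp only [chebMul, hr, chebEval]
  norm_num [Polynomial.Chebyshev.T_neg]
  ring

/-- The Chebyshev coefficients of `(4 q) ^ length l * eval l x` in the variable `y` with
`x = p * (1 + y) / (2 * q)`. -/
def toCheb (p q : ℤ) : List ℤ → List ℤ × ℤ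
  | [] => ([], 1)
  | c :: l =>
    match toCheb p q l with
    | (m, s) => (add [c * (4 * q * s)] (add (smul (2 * p) m) (smul p (chebMul m))), 4 * q * s)

/-- Horner's scheme: 4q x = 2p + p (2y), and multiplication by 2y keeps Chebyshev coefficients
integral, so only the common scale grows, by 4q per step. -/
theorem chebEval_toCheb (p q : ℤ) (l : List ℤ) {x y : ℝ} (h : 2 * q * x = p * (1 + y)) :
    chebEval 0 (toCheb p q l).1 y = (toCheb p q l).2 * eval l x := by
  induction l with
  | nil => simp [toCheb, chebEval, eval]
  | cons c l ih =>
    simp only [toCheb]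
    rw [chebEval_add, chebEval_add, chebEval_smul, chebEval_smul]
    have e : chebEval 0 (chebMul (toCheb p q l).1) y
        = 2 * y * chebEval 0 (toCheb p q l).1 y := by
      by_cases h0 : (toCheb p q l).1 = []
      · simp [h0, chebMul, add, chebEval]
      · exact chebEval_chebMul h0 y
    rw [e, ih]
    simp only [chebEval, eval, Polynomial.Chebyshev.T_zero, Polynomial.eval_one]
    push_cast
    linear_combination (-2 : ℝ) * (toCheb p q l).2 * eval l x * h

/-- The sum of the absolute values of the coefficients. -/
def absSum : List ℤ → ℤ
  | [] => 0
  | c :: l => |c| + absSum l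

theorem abs_chebEval_le (n : ℤ) (l : List ℤ) {y : ℝ} (hy : |y| ≤ 1) :
    |chebEval n l y| ≤ absSum l := by
  induction l generalizing n with
  | nil => simp [chebEval, absSum]
  | cons c l ih =>
    simp only [chebEval, absSum, Int.cast_add, Int.cast_abs]
    refine (abs_add_le _ _).trans (add_le_add ?_ (ih _))
    rw [abs_mul]
    exact mul_le_of_le_one_right (abs_nonneg _)
      (Polynomial.Chebyshev.abs_eval_T_real_le_one n hy)

/-- A test for `k * |eval l x| ≤ B` on `[0, p / q]`. -/
def boundTest (p q : ℤ) (k B : ℤ) (l : List ℤ) : Bool :=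
  match toCheb p q l with
  | (m, s) => decide (0 < s ∧ k * absSum m ≤ B * s)

/-- The interval is mapped affinely onto [-1, 1], where |Tₙ| ≤ 1, so the absolute sum of the
Chebyshev coefficients bounds the polynomial. -/
theorem abs_eval_le {p q k B : ℤ} {l : List ℤ} (hp : 0 < p) (hq : 0 < q) (hk : 0 ≤ k)
    (h : boundTest p q k B l = true) {x : ℝ} (hx : x ∈ Icc (0 : ℝ) (p / q)) :
    k * |eval l x| ≤ B := by
  have hp' : (0 : ℝ) < p := by exact_mod_cast hp
  have hq' : (0 : ℝ) < q := by exact_mod_cast hq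
  simp only [boundTest, decide_eq_true_eq] at h
  obtain ⟨hs, hB⟩ := h
  have hs' : (0 : ℝ) < (toCheb p q l).2 := by exact_mod_cast hs
  have hB' : (k : ℝ) * absSum (toCheb p q l).1 ≤ B * (toCheb p q l).2 := by exact_mod_cast hB
  have hk' : (0 : ℝ) ≤ k := by exact_mod_cast hk
  have hxq : q * x ≤ p := by
    have := hx.2
    rw [le_div_iff₀ hq'] at this
    linarith
  have hx0 := hx.1
  set y : ℝ := 2 * q * x / p - 1 with hy
  have hxy : 2 * q * x = p * (1 + y) := by rw [hy]; field_simp; ring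
  have hy1 : |y| ≤ 1 := by
    rw [abs_le]
    constructor
    · rw [hy]; linarith [show 0 ≤ 2 * q * x / p by positivity]
    · rw [hy]
      have : 2 * q * x / p ≤ 2 := by rw [div_le_iff₀ hp']; linarith
      linarith
  have e := abs_chebEval_le 0 (toCheb p q l).1 hy1
  rw [chebEval_toCheb p q l hxy, abs_mul, abs_of_pos hs'] at e
  have : (toCheb p q l).2 * (k * |eval l x|) ≤ (toCheb p q l).2 * (B : ℝ) := by
    nlinarith [mul_le_mul_of_nonneg_left e hk']
  exact le_of_mul_le_mul_left this hs'

end IntPoly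

/-! ### Polynomial data and integer certificates -/

/-- The coefficients, scaled by `6 * 10 ^ 34`, of a polynomial that approximates on `[0, 9 / 2]`
the integral of the solution of the initial value problem. -/
def integralCoeff : List ℤ :=
  [0, 0, 0, 10000000000000000000000000000000000, 3728774801176707929300820,
   -241561472925290463583590151, -83328996897313742872829245515759,
   -39825038534393923990496661115, 226714298873000360129947004955,
   936605928826177437162547875235, 2490687830934194876488414658250,
   -5310942241508118359415844378805, 8752020202165113712908059380279,
   -11563442249539243192494443624046, 12239389735562579329150036485599,
   -10550031911753107738716886081617, 7467627063931637399406471458494,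
   -4361976352868436297449665766198, 2109088253717997101040230862757,
   -844963019806074789562304176912, 280196544752749553612056789780,
   -76691686436761570003371819064, 17244547461291140253952855543, -3162771511005217368544467404,
   468149790790931401057095410, -55052071861813639367335430, 5023331603799916275338540,
   -342887689443998881384862, 16478251664269676589149, -497338379298342121515,
   7092980350684298430]

/-- The coefficients of `F₀near`, scaled by their common denominator. -/
def nearCoeff : List ℤ :=
  [0, 0, 744661185160915875789382991045412107311439754263818359375000, 0,
   -1211973151147539387750190145470591738259978466796875000,
   -12397132126939125731712608599603791451504144314776953125000,
   -77302102781574200179269525542289199369400378112812500000,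
   253812117050914603931152494924965835753203916906000000000,
   -133894399601317879348148337923271071391616893896437500000,
   784851261040076849878592621924502015465856020474352734375,
   -799702779815952076100165442946122045004668772019467000000,
   562364832627562134313288343807271805691962712520748800000,
   -290941643019530550442412080608611637833611611318589104000,
   99399889843368940569340490479346967267385667436065280000,
   -20813579882876934704008835389195161860621101184621568000,
   2427074429973118182536335367899091954967065868788367360,
   -121353721490138441888624925957411820097178939478413312]

/-- The common denominator of the coefficients of `F₀near`. -/
def nearDenom : ℕ :=
  1489322370321831751578765982090824214622879508527636718750000

open IntPoly in
/-- Coefficients of the residual of the approximation, scaled by `(6 * 10 ^ 34) ^ 2`. -/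
def residualCoeff : List ℤ :=
  add (smul (6 * 10 ^ 34) (derivCoeff (derivCoeff (derivCoeff (derivCoeff integralCoeff)))))
    (mul (derivCoeff integralCoeff) (derivCoeff (derivCoeff (derivCoeff integralCoeff))))

open IntPoly in
/-- Coefficients of the difference of `F₀near` and the derivative of the approximation of the
integral, scaled by `6 * 10 ^ 34 * nearDenom`. -/
def differenceCoeff : List ℤ :=
  add (smul (6 * 10 ^ 34) nearCoeff) (smul (-nearDenom) (derivCoeff integralCoeff))

/-- Certifies a residual of at most 2e-9 on [0, 9/2]. Monomial coefficients would not do: the one of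
x alone contributes about 2e-6 at the right end. -/
theorem residual_test :
    IntPoly.boundTest 9 2 (10 ^ 9) (2 * (6 * 10 ^ 34) ^ 2) residualCoeff = true := by
  decide +kernel

/-- This and the next two tests certify that `F₀near` and its first two derivatives are within 3e-7
of the polynomial approximation on [0, 5/2]. -/
theorem difference_test_zero :
    IntPoly.boundTest 5 2 (10 ^ 7) (3 * (6 * 10 ^ 34 * nearDenom)) differenceCoeff = true := by
  decide +kernel

theorem difference_test_one :
    IntPoly.boundTest 5 2 (10 ^ 7) (3 * (6 * 10 ^ 34 * nearDenom))
      (IntPoly.derivCoeff differenceCoeff) = true := by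
  decide +kernel

theorem difference_test_two :
    IntPoly.boundTest 5 2 (10 ^ 7) (3 * (6 * 10 ^ 34 * nearDenom))
      (IntPoly.derivCoeff (IntPoly.derivCoeff differenceCoeff)) = true := by
  decide +kernel

/-! ### Monotonicity and Grönwall estimates on half-lines -/

theorem antitoneOn_Ici_of_hasDerivWithinAt {f f' : ℝ → ℝ} {x₀ : ℝ}
    (hf : ∀ x, x₀ ≤ x → HasDerivWithinAt f (f' x) (Ici x₀) x) (h : ∀ x, x₀ ≤ x → f' x ≤ 0) :
    AntitoneOn f (Ici x₀) := by
  refine antitoneOn_of_hasDerivWithinAt_nonpos (f' := f') (convex_Ici x₀)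
    (fun x hx => (hf x hx).continuousWithinAt) (fun x hx => ?_) (fun x hx => ?_)
  · rw [interior_Ici] at hx ⊢
    exact (hf x hx.le).mono Ioi_subset_Ici_self
  · rw [interior_Ici] at hx
    exact h x hx.le

theorem monotoneOn_Ici_of_hasDerivWithinAt {f f' : ℝ → ℝ} {x₀ : ℝ}
    (hf : ∀ x, x₀ ≤ x → HasDerivWithinAt f (f' x) (Ici x₀) x) (h : ∀ x, x₀ ≤ x → 0 ≤ f' x) :
    MonotoneOn f (Ici x₀) := by
  have := (antitoneOn_Ici_of_hasDerivWithinAt (f := fun x => -f x) (fun x hx => (hf x hx).neg)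
    (fun x hx => neg_nonpos.2 (h x hx))).neg
  simpa using! this

theorem eq_left_of_hasDerivWithinAt_zero {f f' : ℝ → ℝ} {x₀ : ℝ}
    (hf : ∀ x, x₀ ≤ x → HasDerivWithinAt f (f' x) (Ici x₀) x) (h : ∀ x, x₀ ≤ x → f' x = 0)
    {x : ℝ} (hx : x₀ ≤ x) : f x = f x₀ :=
  le_antisymm
    (antitoneOn_Ici_of_hasDerivWithinAt hf (fun x hx => (h x hx).le) self_mem_Ici hx hx)
    (monotoneOn_Ici_of_hasDerivWithinAt hf (fun x hx => (h x hx).ge) self_mem_Ici hx hx)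

theorem nonneg_of_antitoneOn_of_tendsto {f : ℝ → ℝ} {x₀ x : ℝ} (hf : AntitoneOn f (Ici x₀))
    (h : Tendsto f atTop (𝓝 0)) (hx : x₀ ≤ x) : 0 ≤ f x :=
  le_of_tendsto h <| (eventually_ge_atTop x).mono fun _ hy => hf hx (hx.trans hy) hy

/-- A function that tends to zero is bounded by another one if its derivative is. -/
theorem tail_le {f k B κ : ℝ → ℝ} {x₀ : ℝ}
    (hf : ∀ x, x₀ ≤ x → HasDerivWithinAt f (-k x) (Ici x₀) x)
    (hB : ∀ x, x₀ ≤ x → HasDerivWithinAt B (-κ x) (Ici x₀) x)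
    (hk : ∀ x, x₀ ≤ x → k x ≤ κ x)
    (hf0 : Tendsto f atTop (𝓝 0)) (hB0 : Tendsto B atTop (𝓝 0)) {x : ℝ} (hx : x₀ ≤ x) :
    f x ≤ B x := by
  have h := antitoneOn_Ici_of_hasDerivWithinAt (f := fun x => B x - f x)
    (fun x hx => (hB x hx).sub (hf x hx)) (fun x hx => by linarith [hk x hx])
  have := nonneg_of_antitoneOn_of_tendsto h (by simpa using hB0.sub hf0) hx
  linarith

theorem tail_nonneg {f k : ℝ → ℝ} {x₀ : ℝ}
    (hf : ∀ x, x₀ ≤ x → HasDerivWithinAt f (-k x) (Ici x₀) x)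
    (hk : ∀ x, x₀ ≤ x → 0 ≤ k x) (hf0 : Tendsto f atTop (𝓝 0)) {x : ℝ} (hx : x₀ ≤ x) :
    0 ≤ f x :=
  nonneg_of_antitoneOn_of_tendsto
    (antitoneOn_Ici_of_hasDerivWithinAt hf (fun x hx => by linarith [hk x hx])) hf0 hx

theorem abs_tail_le {f k B κ : ℝ → ℝ} {x₀ : ℝ}
    (hf : ∀ x, x₀ ≤ x → HasDerivWithinAt f (k x) (Ici x₀) x)
    (hB : ∀ x, x₀ ≤ x → HasDerivWithinAt B (-κ x) (Ici x₀) x)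
    (hk : ∀ x, x₀ ≤ x → |k x| ≤ κ x)
    (hf0 : Tendsto f atTop (𝓝 0)) (hB0 : Tendsto B atTop (𝓝 0)) {x : ℝ} (hx : x₀ ≤ x) :
    |f x| ≤ B x := by
  refine abs_le'.2 ⟨?_, ?_⟩
  · exact tail_le (k := fun x => -k x) (fun x hx => by simpa using hf x hx) hB
      (fun x hx => (neg_le_abs _).trans (hk x hx)) hf0 hB0 hx
  · exact tail_le (f := fun x => -f x) (fun x hx => (hf x hx).neg) hB
      (fun x hx => (le_abs_self _).trans (hk x hx)) (by simpa using hf0.neg) hB0 hx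

/-- A function whose derivative is nonpositive and dominated has a limit. -/
theorem exists_tendsto_of_tail {f k B κ : ℝ → ℝ} {x₀ : ℝ}
    (hf : ∀ x, x₀ ≤ x → HasDerivWithinAt f (-k x) (Ici x₀) x)
    (hB : ∀ x, x₀ ≤ x → HasDerivWithinAt B (-κ x) (Ici x₀) x)
    (hk0 : ∀ x, x₀ ≤ x → 0 ≤ k x) (hk : ∀ x, x₀ ≤ x → k x ≤ κ x)
    (hB0 : Tendsto B atTop (𝓝 0)) : ∃ l, Tendsto f atTop (𝓝 l) := by
  have hanti := antitoneOn_Ici_of_hasDerivWithinAt hf (fun x hx => by linarith [hk0 x hx])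
  have hmono := monotoneOn_Ici_of_hasDerivWithinAt (f := fun x => f x - B x)
    (fun x hx => (hf x hx).sub (hB x hx)) (fun x hx => by linarith [hk x hx])
  have hBpos : ∀ x, x₀ ≤ x → 0 ≤ B x := fun x hx =>
    tail_nonneg hB (fun y hy => (hk0 y hy).trans (hk y hy)) hB0 hx
  -- Freezing f to the left of x₀ makes it antitone on the whole line; it is bounded below because f
  -- - B increases and B ≥ 0.
  have hg : Antitone fun x => f (max x x₀) := fun x y hxy =>
    hanti (mem_Ici.2 (le_max_right _ _)) (mem_Ici.2 (le_max_right _ _)) (max_le_max_right _ hxy)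
  have hbdd : BddBelow (range fun x => f (max x x₀)) := by
    refine ⟨f x₀ - B x₀, ?_⟩
    rintro _ ⟨x, rfl⟩
    have h1 := hmono self_mem_Ici (le_max_right x x₀) (le_max_right x x₀)
    have h2 := hBpos (max x x₀) (le_max_right x x₀)
    simp only at h1 ⊢
    linarith
  refine ⟨_, (tendsto_atTop_ciInf hg hbdd).congr' ?_⟩
  filter_upwards [eventually_ge_atTop x₀] with x hx
  rw [max_eq_left hx]

/-- Grönwall's estimate for a third order differential inequality. -/
theorem abs_le_of_third_deriv {f₀ f₁ f₂ f₃ : ℝ → ℝ} {X ε : ℝ}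
    (h₀ : ∀ x ∈ Icc 0 X, HasDerivWithinAt f₀ (f₁ x) (Ici 0) x)
    (h₁ : ∀ x ∈ Icc 0 X, HasDerivWithinAt f₁ (f₂ x) (Ici 0) x)
    (h₂ : ∀ x ∈ Icc 0 X, HasDerivWithinAt f₂ (f₃ x) (Ici 0) x)
    (z₀ : f₀ 0 = 0) (z₁ : f₁ 0 = 0) (z₂ : f₂ 0 = 0) (hε : 0 ≤ ε)
    (hb : ∀ x ∈ Icc 0 X, |f₃ x| ≤ |f₀ x| + ε) {x : ℝ} (hx : x ∈ Icc 0 X) :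
    |f₀ x| ≤ ε * (Real.exp x - 1) ∧ |f₁ x| ≤ ε * (Real.exp x - 1) ∧
      |f₂ x| ≤ ε * (Real.exp x - 1) := by
  have hd : ∀ x ∈ Icc 0 X, HasDerivWithinAt (fun x => (f₀ x, f₁ x, f₂ x)) (f₁ x, f₂ x, f₃ x)
      (Ici 0) x := fun x hx => (h₀ x hx).prodMk ((h₁ x hx).prodMk (h₂ x hx))
  -- In the sup norm of the triple, the first two entries of the derivative are entries of the
  -- triple itself and the third exceeds |f₀| by at most ε, so the Grönwall constant is 1.
  have key := norm_le_gronwallBound_of_norm_deriv_right_le (δ := 0) (K := 1) (ε := ε)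
    (f := fun x => (f₀ x, f₁ x, f₂ x)) (f' := fun x => (f₁ x, f₂ x, f₃ x)) (a := 0) (b := X)
    (fun x hx => ((hd x hx).mono Icc_subset_Ici_self).continuousWithinAt)
    (fun x hx => (hd x (Ico_subset_Icc_self hx)).mono (Ici_subset_Ici.2 hx.1))
    (by simp [z₀, z₁, z₂]) (fun x hx => ?_) x hx
  · rw [gronwallBound_of_K_ne_0 one_ne_zero] at key
    simp only [zero_mul, sub_zero, one_mul, zero_add, div_one, Prod.norm_def, Real.norm_eq_abs,
      max_le_iff] at key
    exact key
  · have h := hb x (Ico_subset_Icc_self hx)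
    simp only [Prod.norm_def, Real.norm_eq_abs, one_mul]
    refine max_le ?_ (max_le ?_ (h.trans ?_))
    · linarith [le_max_left |f₁ x| |f₂ x|, le_max_right |f₀ x| (max |f₁ x| |f₂ x|)]
    · linarith [le_max_right |f₁ x| |f₂ x|, le_max_right |f₀ x| (max |f₁ x| |f₂ x|)]
    · linarith [le_max_left |f₀ x| (max |f₁ x| |f₂ x|)]

/-! ### Solutions as first order systems -/

theorem iteratedDerivWithin_two_of_hasDerivWithinAt {F p u : ℝ → ℝ} {s : Set ℝ}
    (hs : UniqueDiffOn ℝ s) (hF : ∀ x ∈ s, HasDerivWithinAt F (p x) s x)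
    (hp : ∀ x ∈ s, HasDerivWithinAt p (u x) s x) {x : ℝ} (hx : x ∈ s) :
    iteratedDerivWithin 2 F s x = u x := by
  have h1 : ∀ y ∈ s, derivWithin F s y = p y := fun y hy => (hF y hy).derivWithin (hs y hy)
  rw [iteratedDerivWithin_succ, iteratedDerivWithin_one, derivWithin_congr h1 (h1 x hx)]
  exact (hp x hx).derivWithin (hs x hx)

theorem iteratedDerivWithin_three_of_hasDerivWithinAt {F p u w : ℝ → ℝ} {s : Set ℝ}
    (hs : UniqueDiffOn ℝ s) (hF : ∀ x ∈ s, HasDerivWithinAt F (p x) s x)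
    (hp : ∀ x ∈ s, HasDerivWithinAt p (u x) s x) (hu : ∀ x ∈ s, HasDerivWithinAt u (w x) s x)
    {x : ℝ} (hx : x ∈ s) : iteratedDerivWithin 3 F s x = w x := by
  have h2 : ∀ y ∈ s, iteratedDerivWithin 2 F s y = u y := fun y hy =>
    iteratedDerivWithin_two_of_hasDerivWithinAt hs hF hp hy
  rw [iteratedDerivWithin_succ, derivWithin_congr h2 (h2 x hx)]
  exact (hu x hx).derivWithin (hs x hx)

theorem contDiffOn_succ_of_hasDerivWithinAt {F p : ℝ → ℝ} {s : Set ℝ} (n : ℕ)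
    (hs : UniqueDiffOn ℝ s) (hF : ∀ x ∈ s, HasDerivWithinAt F (p x) s x)
    (hp : ContDiffOn ℝ n p s) : ContDiffOn ℝ ((n : WithTop ℕ∞) + 1) F s := by
  rw [contDiffOn_succ_iff_derivWithin hs]
  refine ⟨fun x hx => (hF x hx).differentiableWithinAt, by simp, hp.congr fun x hx => ?_⟩
  exact (hF x hx).derivWithin (hs x hx)

/-- `F' = p`, `p' = u`, `u' = - F u` on `[0, ∞)`, with `F 0 = p 0 = 0`. -/
structure IsFlow (F p u : ℝ → ℝ) : Prop where
  hF : ∀ x, 0 ≤ x → HasDerivWithinAt F (p x) (Ici 0) x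
  hp : ∀ x, 0 ≤ x → HasDerivWithinAt p (u x) (Ici 0) x
  hu : ∀ x, 0 ≤ x → HasDerivWithinAt u (-(F x * u x)) (Ici 0) x
  F_zero : F 0 = 0
  p_zero : p 0 = 0

namespace IsFlow

variable {F p u : ℝ → ℝ}

theorem derivWithin_eq (h : IsFlow F p u) {x : ℝ} (hx : 0 ≤ x) :
    derivWithin F (Ici 0) x = p x :=
  (h.hF x hx).derivWithin (uniqueDiffOn_Ici 0 x hx)

theorem iteratedDerivWithin_two (h : IsFlow F p u) {x : ℝ} (hx : 0 ≤ x) :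
    iteratedDerivWithin 2 F (Ici 0) x = u x :=
  iteratedDerivWithin_two_of_hasDerivWithinAt (uniqueDiffOn_Ici 0) h.hF h.hp hx

theorem ode (h : IsFlow F p u) {x : ℝ} (hx : 0 ≤ x) :
    iteratedDerivWithin 3 F (Ici 0) x + F x * iteratedDerivWithin 2 F (Ici 0) x = 0 := by
  rw [h.iteratedDerivWithin_two hx,
    iteratedDerivWithin_three_of_hasDerivWithinAt (uniqueDiffOn_Ici 0) h.hF h.hp h.hu hx]
  ring

theorem contDiffOn (h : IsFlow F p u) : ContDiffOn ℝ 3 F (Ici 0) := by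
  have cF : ContinuousOn F (Ici 0) := fun x hx => (h.hF x hx).continuousWithinAt
  have cu : ContinuousOn u (Ici 0) := fun x hx => (h.hu x hx).continuousWithinAt
  have h0 : ContDiffOn ℝ ((0 : ℕ) : WithTop ℕ∞) (fun x => -(F x * u x)) (Ici 0) := by
    exact contDiffOn_zero.2 (cF.mul cu).neg
  have h1 := contDiffOn_succ_of_hasDerivWithinAt 0 (uniqueDiffOn_Ici 0) h.hu h0
  have h2 := contDiffOn_succ_of_hasDerivWithinAt 1 (uniqueDiffOn_Ici 0) h.hp (by simpa using h1)
  have h3 := contDiffOn_succ_of_hasDerivWithinAt 2 (uniqueDiffOn_Ici 0) h.hF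
    (by norm_num at h2 ⊢; exact h2)
  norm_num at h3
  exact h3

theorem isInitialValueSolution (h : IsFlow F p u) (h1 : u 0 = 1) : IsInitialValueSolution F where
  contDiffOn := h.contDiffOn
  ode _ hx := h.ode (le_of_lt hx)
  value_zero := h.F_zero
  deriv_zero := (h.derivWithin_eq le_rfl).trans h.p_zero
  deriv_two_zero := (h.iteratedDerivWithin_two le_rfl).trans h1

theorem isBlasiusSolution (h : IsFlow F p u) (h1 : Tendsto p atTop (𝓝 1)) :
    IsBlasiusSolution F where
  contDiffOn := h.contDiffOn
  ode _ hx := h.ode (le_of_lt hx)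
  value_zero := h.F_zero
  deriv_zero := (h.derivWithin_eq le_rfl).trans h.p_zero
  deriv_tendsto := h1.congr' <| (eventually_ge_atTop 0).mono fun _ hx => (h.derivWithin_eq hx).symm

theorem of_contDiffOn {F : ℝ → ℝ} (h : ContDiffOn ℝ 3 F (Ici 0))
    (ode : ∀ x ∈ Ioi (0 : ℝ),
      iteratedDerivWithin 3 F (Ici 0) x + F x * iteratedDerivWithin 2 F (Ici 0) x = 0)
    (h0 : F 0 = 0) (h1 : derivWithin F (Ici 0) 0 = 0) :
    IsFlow F (derivWithin F (Ici 0)) (iteratedDerivWithin 2 F (Ici 0)) := by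
  have hd : ∀ n : ℕ, n < 3 → ∀ x ∈ Ici (0 : ℝ), HasDerivWithinAt (iteratedDerivWithin n F (Ici 0))
      (iteratedDerivWithin (n + 1) F (Ici 0) x) (Ici 0) x := by
    intro n hn x hx
    have := (h.differentiableOn_iteratedDerivWithin (m := n) (by exact_mod_cast hn)
      (uniqueDiffOn_Ici 0)) x hx
    rw [iteratedDerivWithin_succ]
    exact this.hasDerivWithinAt
  -- The equation is given only for x > 0; continuity of both sides extends it to the endpoint.
  have ode' : ∀ x ∈ Ici (0 : ℝ),
      iteratedDerivWithin 3 F (Ici 0) x + F x * iteratedDerivWithin 2 F (Ici 0) x = 0 := by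
    have c3 : ContinuousOn (iteratedDerivWithin 3 F (Ici 0)) (Ici 0) :=
      h.continuousOn_iteratedDerivWithin (by norm_num) (uniqueDiffOn_Ici 0)
    have c2 : ContinuousOn (iteratedDerivWithin 2 F (Ici 0)) (Ici 0) :=
      h.continuousOn_iteratedDerivWithin (by norm_num) (uniqueDiffOn_Ici 0)
    exact Set.EqOn.of_subset_closure (g := fun _ => (0 : ℝ)) ode
      (c3.add (h.continuousOn.mul c2)) continuousOn_const Ioi_subset_Ici_self
      (by rw [closure_Ioi])
  refine ⟨fun x hx => ?_, fun x hx => ?_, fun x hx => ?_, h0, h1⟩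
  · have := hd 0 (by norm_num) x hx
    rw [zero_add, iteratedDerivWithin_one] at this
    simpa using this
  · have := hd 1 (by norm_num) x hx
    have e : iteratedDerivWithin 1 F (Ici 0) = derivWithin F (Ici 0) :=
      iteratedDerivWithin_one
    rwa [e] at this
  · have := hd 2 (by norm_num) x hx
    rwa [show iteratedDerivWithin (2 + 1) F (Ici 0) x
      = -(F x * iteratedDerivWithin 2 F (Ici 0) x) by linarith [ode' x hx]] at this

/-- The integral of the first component, extended by a constant to the left of `0`. -/
theorem exists_integral (h : IsFlow F p u) : ∃ S : ℝ → ℝ, S 0 = 0 ∧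
    (∀ x, 0 ≤ x → HasDerivWithinAt S (F x) (Ici 0) x) ∧
    ∀ x, 0 ≤ x → u x = u 0 * Real.exp (-S x) := by
  have cF : ContinuousOn F (Ici 0) := fun x hx => (h.hF x hx).continuousWithinAt
  have cG : Continuous fun x => F (max x 0) :=
    cF.comp_continuous (continuous_id.max continuous_const) fun x => mem_Ici.2 (le_max_right _ _)
  have hS : ∀ x, 0 ≤ x → HasDerivWithinAt (fun x => ∫ y in (0 : ℝ)..x, F (max y 0)) (F x)
      (Ici 0) x := by
    intro x hx
    have := (cG.integral_hasStrictDerivAt 0 x).hasDerivAt.hasDerivWithinAt (s := Ici 0)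
    simpa [max_eq_left hx] using this
  refine ⟨_, by simp, hS, fun x hx => ?_⟩
  have hd : ∀ x, 0 ≤ x → HasDerivWithinAt
      (fun x => u x * Real.exp (∫ y in (0 : ℝ)..x, F (max y 0))) _ (Ici 0) x :=
    fun x hx => (h.hu x hx).mul (hS x hx).exp
  -- The integrating factor exp(S) makes u exp(S) constant.
  have := eq_left_of_hasDerivWithinAt_zero hd (fun x _ => by ring) hx
  simp only [intervalIntegral.integral_same, Real.exp_zero, mul_one] at this
  rw [← this, mul_assoc, ← Real.exp_add, add_neg_cancel, Real.exp_zero, mul_one]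

theorem monotone_p (h : IsFlow F p u) (h0 : 0 ≤ u 0) : MonotoneOn p (Ici 0) := by
  obtain ⟨S, -, -, hu⟩ := h.exists_integral
  refine monotoneOn_Ici_of_hasDerivWithinAt h.hp fun x hx => ?_
  rw [hu x hx]
  positivity

theorem p_nonneg (h : IsFlow F p u) (h0 : 0 ≤ u 0) {x : ℝ} (hx : 0 ≤ x) : 0 ≤ p x := by
  simpa [h.p_zero] using h.monotone_p h0 self_mem_Ici hx hx

theorem monotone_F (h : IsFlow F p u) (h0 : 0 ≤ u 0) : MonotoneOn F (Ici 0) :=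
  monotoneOn_Ici_of_hasDerivWithinAt h.hF fun _ hx => h.p_nonneg h0 hx

theorem F_nonneg (h : IsFlow F p u) (h0 : 0 ≤ u 0) {x : ℝ} (hx : 0 ≤ x) : 0 ≤ F x := by
  simpa [h.F_zero] using h.monotone_F h0 self_mem_Ici hx hx

end IsFlow

/-- This Lipschitz constant 1 replaces the nonlinearity in the uniqueness proof, in the contraction
and in the error propagation alike. -/
theorem abs_exp_neg_sub_exp_neg_le {s t : ℝ} (hs : 0 ≤ s) (ht : 0 ≤ t) :
    |Real.exp (-s) - Real.exp (-t)| ≤ |s - t| := by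
  wlog hst : s ≤ t generalizing s t
  · rw [abs_sub_comm, abs_sub_comm s t]
    exact this ht hs (le_of_not_ge hst)
  rw [abs_sub_comm s t, abs_of_nonneg (sub_nonneg.2 hst),
    abs_of_nonneg (sub_nonneg.2 (Real.exp_le_exp.2 (neg_le_neg hst)))]
  have h1 : Real.exp (-t) = Real.exp (-s) * Real.exp (s - t) := by
    rw [← Real.exp_add]; ring_nf
  have h2 := Real.add_one_le_exp (s - t)
  have h3 : Real.exp (-s) ≤ 1 := Real.exp_le_one_iff.2 (by linarith)
  rw [h1]
  nlinarith [Real.exp_pos (-s)]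

theorem IsFlow.exists_integral_nonneg {F p u : ℝ → ℝ} (h : IsFlow F p u) (h1 : u 0 = 1) :
    ∃ S : ℝ → ℝ, S 0 = 0 ∧ (∀ x, 0 ≤ x → HasDerivWithinAt S (F x) (Ici 0) x) ∧
    (∀ x, 0 ≤ x → u x = Real.exp (-S x)) ∧ ∀ x, 0 ≤ x → 0 ≤ S x := by
  obtain ⟨S, S0, hS, hu⟩ := h.exists_integral
  refine ⟨S, S0, hS, by simpa [h1] using hu, fun x hx => ?_⟩
  have := monotoneOn_Ici_of_hasDerivWithinAt hS
    (fun y hy => h.F_nonneg (by rw [h1]; exact zero_le_one) hy) self_mem_Ici hx hx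
  rwa [S0] at this

/-- Grönwall with ε = 0 for the difference of the two integrals, whose third derivative is a
difference of values of exp(-·). -/
theorem IsFlow.eq_of_eq {F p u G q v : ℝ → ℝ} (h : IsFlow F p u) (h1 : u 0 = 1)
    (k : IsFlow G q v) (k1 : v 0 = 1) {x : ℝ} (hx : 0 ≤ x) : G x = F x := by
  obtain ⟨S, S0, hS, hu, hS0⟩ := h.exists_integral_nonneg h1
  obtain ⟨R, R0, hR, hv, hR0⟩ := k.exists_integral_nonneg k1
  have key := abs_le_of_third_deriv (X := x) (ε := 0)
    (fun y hy => (hR y hy.1).sub (hS y hy.1)) (fun y hy => (k.hF y hy.1).sub (h.hF y hy.1))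
    (fun y hy => (k.hp y hy.1).sub (h.hp y hy.1)) (by simp [S0, R0])
    (by simp [h.F_zero, k.F_zero]) (by simp [h.p_zero, k.p_zero]) le_rfl
    (fun y hy => by
      rw [hu y hy.1, hv y hy.1, add_zero]
      exact abs_exp_neg_sub_exp_neg_le (hR0 y hy.1) (hS0 y hy.1)) ⟨hx, le_rfl⟩
  have := key.2.1
  rw [zero_mul] at this
  exact sub_eq_zero.1 (abs_nonpos_iff.1 this)

/-! ### Existence of the solution of the initial value problem -/

/-- The function whose threefold integral enters the fixed point equation. -/
noncomputable def weight (w : BoundedContinuousFunction ℝ ℝ) (x : ℝ) : ℝ :=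
  Real.exp (2 * x) * max (w x) 0

/-- The integral from `0`. -/
noncomputable def primitive (f : ℝ → ℝ) (x : ℝ) : ℝ := ∫ y in (0 : ℝ)..x, f y

theorem continuous_weight (w : BoundedContinuousFunction ℝ ℝ) : Continuous (weight w) := by
  unfold weight
  have := w.continuous
  fun_prop

theorem hasDerivAt_primitive {f : ℝ → ℝ} (hf : Continuous f) (x : ℝ) :
    HasDerivAt (primitive f) (f x) x :=
  (hf.integral_hasStrictDerivAt 0 x).hasDerivAt

theorem continuous_primitive {f : ℝ → ℝ} (hf : Continuous f) : Continuous (primitive f) :=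
  continuous_iff_continuousAt.2 fun x => (hasDerivAt_primitive hf x).continuousAt

theorem primitive_nonneg {f : ℝ → ℝ} (h : ∀ x, 0 ≤ x → 0 ≤ f x) {x : ℝ} (hx : 0 ≤ x) :
    0 ≤ primitive f x :=
  intervalIntegral.integral_nonneg hx fun y hy => h y hy.1

/-- Each integration of the weight exp(2x) gains a factor 1/2; three of them give the contraction
constant 1/8. -/
theorem abs_primitive_sub_le {f g : ℝ → ℝ} (hf : Continuous f) (hg : Continuous g) {d : ℝ}
    (hd : 0 ≤ d) (h : ∀ x, 0 ≤ x → |f x - g x| ≤ d * Real.exp (2 * x)) {x : ℝ} (hx : 0 ≤ x) :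
    |primitive f x - primitive g x| ≤ d / 2 * Real.exp (2 * x) := by
  unfold primitive
  rw [← intervalIntegral.integral_sub (hf.intervalIntegrable _ _) (hg.intervalIntegrable _ _)]
  have h1 : |∫ y in (0 : ℝ)..x, (f y - g y)| ≤ ∫ y in (0 : ℝ)..x, d * Real.exp (2 * y) := by
    rw [← Real.norm_eq_abs]
    refine intervalIntegral.norm_integral_le_of_norm_le hx (ae_of_all _ fun y hy => ?_) ?_
    · exact h y hy.1.le
    · exact Continuous.intervalIntegrable (by fun_prop) _ _
  have h2 : ∫ y in (0 : ℝ)..x, d * Real.exp (2 * y)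
      = d / 2 * Real.exp (2 * x) - d / 2 * Real.exp (2 * 0) := by
    refine intervalIntegral.integral_eq_sub_of_hasDerivAt
      (f := fun y => d / 2 * Real.exp (2 * y)) (fun y _ => ?_)
      (Continuous.intervalIntegrable (by fun_prop) _ _)
    have := (((hasDerivAt_id y).const_mul 2).exp).const_mul (d / 2)
    convert! this using 1
    simp only [id]; ring
  rw [h2] at h1
  refine h1.trans ?_
  simp only [mul_zero, Real.exp_zero, mul_one]
  linarith

theorem primitive_weight_nonneg (w : BoundedContinuousFunction ℝ ℝ) {x : ℝ} (hx : 0 ≤ x) :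
    0 ≤ primitive (primitive (primitive (weight w))) x :=
  primitive_nonneg (fun _ h => primitive_nonneg (fun _ h => primitive_nonneg
    (fun _ _ => mul_nonneg (Real.exp_pos _).le (le_max_right _ _)) h) h) hx

/-- The map whose fixed point yields the weighted second derivative of the solution. -/
noncomputable def picardMap (w : BoundedContinuousFunction ℝ ℝ) :
    BoundedContinuousFunction ℝ ℝ :=
  BoundedContinuousFunction.ofNormedAddCommGroup
    (fun x => Real.exp (-2 * max x 0) *
      Real.exp (-primitive (primitive (primitive (weight w))) (max x 0)))
    (by
      have := continuous_primitive (continuous_primitive (continuous_primitive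
        (continuous_weight w)))
      fun_prop) 1
    (fun x => by
      rw [Real.norm_eq_abs, ← Real.exp_add, Real.abs_exp, Real.exp_le_one_iff]
      linarith [primitive_weight_nonneg w (le_max_right x 0), le_max_right x 0])

theorem picardMap_apply (w : BoundedContinuousFunction ℝ ℝ) (x : ℝ) :
    picardMap w x = Real.exp (-2 * max x 0) *
      Real.exp (-primitive (primitive (primitive (weight w))) (max x 0)) := rfl

/-- The unknown is w = exp(-2x) F''. The weight makes the threefold integral a contraction on the
whole half-line at once, and the truncation of w at 0 keeps that integral nonnegative, where exp(-·)
is 1-Lipschitz. -/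
theorem contractingWith_picardMap : ContractingWith (1 / 8) picardMap := by
  refine ⟨by norm_num [← NNReal.coe_lt_coe], LipschitzWith.of_dist_le_mul fun w v => ?_⟩
  rw [BoundedContinuousFunction.dist_le (by positivity)]
  intro x
  have hx := le_max_right x 0
  have hc := continuous_weight
  have hd : ∀ y, 0 ≤ y → |weight w y - weight v y| ≤ dist w v * Real.exp (2 * y) := by
    intro y _
    unfold weight
    rw [← mul_sub, abs_mul, Real.abs_exp, mul_comm]
    refine mul_le_mul_of_nonneg_right ?_ (Real.exp_pos _).le
    exact (abs_max_sub_max_le_abs _ _ _).trans (w.dist_coe_le_dist (g := v) y)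
  have h1 := fun y (hy : 0 ≤ y) => abs_primitive_sub_le (hc w) (hc v) dist_nonneg hd hy
  have h2 := fun y (hy : 0 ≤ y) => abs_primitive_sub_le (continuous_primitive (hc w))
    (continuous_primitive (hc v)) (by positivity) h1 hy
  have h3 := abs_primitive_sub_le (continuous_primitive (continuous_primitive (hc w)))
    (continuous_primitive (continuous_primitive (hc v))) (by positivity) h2 hx
  rw [picardMap_apply, picardMap_apply, Real.dist_eq, ← mul_sub, abs_mul, Real.abs_exp]
  have h4 := abs_exp_neg_sub_exp_neg_le (primitive_weight_nonneg w hx)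
    (primitive_weight_nonneg v hx)
  have h5 : Real.exp (-2 * max x 0) * Real.exp (2 * max x 0) = 1 := by
    rw [← Real.exp_add]; simp
  calc _ ≤ Real.exp (-2 * max x 0) * (dist w v / 2 / 2 / 2 * Real.exp (2 * max x 0)) :=
        mul_le_mul_of_nonneg_left (h4.trans h3) (Real.exp_pos _).le
    _ = dist w v / 2 / 2 / 2 * (Real.exp (-2 * max x 0) * Real.exp (2 * max x 0)) := by ring
    _ = _ := by rw [h5]; push_cast; ring

theorem exists_isFlow : ∃ F p u : ℝ → ℝ, IsFlow F p u ∧ u 0 = 1 := by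
  set w := ContractingWith.fixedPoint picardMap contractingWith_picardMap with hw
  have hfix : picardMap w = w := contractingWith_picardMap.fixedPoint_isFixedPt
  have hc := continuous_weight w
  set S := primitive (primitive (primitive (weight w))) with hS
  have hk : ∀ x, 0 ≤ x → weight w x = Real.exp (-S x) := by
    intro x hx
    have := picardMap_apply w x
    rw [hfix, max_eq_left hx] at this
    unfold weight
    -- The fixed point is positive, so the truncation has no effect on it.
    rw [max_eq_left (by rw [this]; positivity), this, ← mul_assoc, ← Real.exp_add]
    simp [hS]
  refine ⟨primitive (primitive (weight w)), primitive (weight w), fun x => Real.exp (-S x),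
    ⟨fun x _ => ?_, fun x hx => ?_, fun x _ => ?_, ?_, ?_⟩, ?_⟩
  · exact (hasDerivAt_primitive (continuous_primitive hc) x).hasDerivWithinAt
  · rw [← hk x hx]
    exact (hasDerivAt_primitive hc x).hasDerivWithinAt
  · have := (hasDerivAt_primitive (continuous_primitive (continuous_primitive hc)) x).neg.exp
    refine (this.congr_deriv ?_).hasDerivWithinAt
    simp only [Pi.neg_apply, hS]
    ring
  · simp [primitive]
  · simp [primitive]
  · simp [hS, primitive]

/-! ### Enclosure of the solution on `[0, 9 / 2]` -/

section Enclosure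

open IntPoly

/-- The polynomial approximation of the integral of the solution. -/
noncomputable def approxS (x : ℝ) : ℝ := eval integralCoeff x / (6 * 10 ^ 34)

/-- The polynomial approximation of the solution. -/
noncomputable def approxF (x : ℝ) : ℝ := eval (derivCoeff integralCoeff) x / (6 * 10 ^ 34)

/-- The polynomial approximation of the first derivative of the solution. -/
noncomputable def approxP (x : ℝ) : ℝ := eval (derivCoeff (derivCoeff integralCoeff)) x / (6 * 10 ^ 34)

/-- The polynomial approximation of the second derivative of the solution. -/
noncomputable def approxU (x : ℝ) : ℝ :=
  eval (derivCoeff (derivCoeff (derivCoeff integralCoeff))) x / (6 * 10 ^ 34)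

/-- The residual of the approximation. -/
noncomputable def approxResidual (x : ℝ) : ℝ := eval residualCoeff x / (6 * 10 ^ 34) ^ 2

theorem hasDerivAt_approxS (x : ℝ) : HasDerivAt approxS (approxF x) x :=
  (hasDerivAt_eval _ x).div_const _

theorem hasDerivAt_approxF (x : ℝ) : HasDerivAt approxF (approxP x) x :=
  (hasDerivAt_eval _ x).div_const _

theorem hasDerivAt_approxP (x : ℝ) : HasDerivAt approxP (approxU x) x :=
  (hasDerivAt_eval _ x).div_const _

theorem hasDerivAt_approxU (x : ℝ) :
    HasDerivAt approxU (approxResidual x - approxF x * approxU x) x := by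
  refine ((hasDerivAt_eval _ x).div_const _).congr_deriv ?_
  simp only [approxResidual, approxF, approxU, residualCoeff, eval_add, eval_smul, eval_mul]
  push_cast
  ring

theorem abs_residual_le {x : ℝ} (hx : x ∈ Icc (0 : ℝ) (9 / 2)) : |approxResidual x| ≤ 2e-9 := by
  have h := abs_eval_le (by norm_num) (by norm_num) (by norm_num) residual_test
    (x := x) (by simpa using hx)
  rw [approxResidual, abs_div, abs_of_pos (show (0 : ℝ) < (6 * 10 ^ 34) ^ 2 by positivity),
    div_le_iff₀ (by positivity)]
  push_cast at h
  linarith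

/-- The double zero at 0 is divided out. The scaled quotient runs from 3e34 at 0 to about 1.74e34 at
9/2, so a distance of at most 24e33 from the central value 24e33 proves it nonnegative. -/
theorem approxF_nonneg {x : ℝ} (hx : x ∈ Icc (0 : ℝ) (9 / 2)) : 0 ≤ approxF x := by
  have h := abs_eval_le (p := 9) (q := 2) (k := 1) (B := 24 * 10 ^ 33)
    (l := add [-(24 * 10 ^ 33)] ((derivCoeff integralCoeff).drop 2)) (by norm_num) (by norm_num)
    (by norm_num) (by decide +kernel) (x := x) (by simpa using hx)
  have e : derivCoeff integralCoeff = 0 :: 0 :: (derivCoeff integralCoeff).drop 2 := by decide +kernel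
  have e' : eval (derivCoeff integralCoeff) x = x ^ 2 * eval ((derivCoeff integralCoeff).drop 2) x := by
    rw [e]
    simp only [eval, List.drop]
    push_cast
    ring
  rw [eval_add] at h
  simp only [eval] at h
  push_cast at h
  rw [one_mul, mul_zero, add_zero] at h
  rw [approxF, e']
  have := (abs_le.1 h).1
  have h2 : 0 ≤ eval ((derivCoeff integralCoeff).drop 2) x := by linarith
  positivity

theorem approxS_zero : approxS 0 = 0 := by
  simp [approxS, integralCoeff, eval]

theorem approxF_zero : approxF 0 = 0 := by
  have e : derivCoeff integralCoeff = 0 :: (derivCoeff integralCoeff).drop 1 := by decide +kernel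
  rw [approxF, e]
  simp [eval]

theorem approxP_zero : approxP 0 = 0 := by
  have e : derivCoeff (derivCoeff integralCoeff) = 0 :: (derivCoeff (derivCoeff integralCoeff)).drop 1 := by
    decide +kernel
  rw [approxP, e]
  simp [eval]

theorem approxU_zero : approxU 0 = 1 := by
  have e : derivCoeff (derivCoeff (derivCoeff integralCoeff))
      = (6 * 10 ^ 34) :: (derivCoeff (derivCoeff (derivCoeff integralCoeff))).drop 1 := by
    decide +kernel
  rw [approxU, e]
  norm_num [eval]

theorem approxS_nonneg {x : ℝ} (hx : x ∈ Icc (0 : ℝ) (9 / 2)) : 0 ≤ approxS x := by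
  have h : MonotoneOn approxS (Icc 0 (9 / 2)) :=
    monotoneOn_of_hasDerivWithinAt_nonneg (convex_Icc _ _)
      (fun x _ => (hasDerivAt_approxS x).continuousAt.continuousWithinAt)
      (fun x _ => (hasDerivAt_approxS x).hasDerivWithinAt)
      (fun x hx => approxF_nonneg (interior_subset hx))
  have := h (left_mem_Icc.2 (by norm_num)) hx hx.1
  rwa [approxS_zero] at this

/-- The derivative of `approxU` times exp(`approxS`) is the residual times exp(`approxS`). Since
`approxS` increases, integration costs only a factor x ≤ 9/2, and 2e-9 times 9/2 is 9e-9. -/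
theorem abs_approxU_sub_exp_le {x : ℝ} (hx : x ∈ Icc (0 : ℝ) (9 / 2)) :
    |approxU x - Real.exp (-approxS x)| ≤ 9e-9 := by
  have hd : ∀ y, HasDerivAt (fun y => approxU y * Real.exp (approxS y) - 1)
      (approxResidual y * Real.exp (approxS y)) y := fun y => by
    refine (((hasDerivAt_approxU y).mul (hasDerivAt_approxS y).exp).sub_const 1).congr_deriv ?_
    ring
  have hB : ∀ y, HasDerivAt (fun y => 2e-9 * y * Real.exp (approxS y))
      (2e-9 * Real.exp (approxS y) + 2e-9 * y * (Real.exp (approxS y) * approxF y)) y := fun y => by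
    refine (((hasDerivAt_id y).const_mul 2e-9).mul (hasDerivAt_approxS y).exp).congr_deriv ?_
    simp
  -- The barrier 2e-9 y exp(`approxS` y) grows fast enough because `approxF` is nonnegative.
  have h := image_norm_le_of_norm_deriv_right_le_deriv_boundary (a := 0) (b := 9 / 2)
    (fun y _ => (hd y).continuousAt.continuousWithinAt) (fun y _ => (hd y).hasDerivWithinAt)
    (by simp [approxS_zero, approxU_zero]) hB (fun y hy => by
      have hy' := Ico_subset_Icc_self hy
      rw [Real.norm_eq_abs, abs_mul, Real.abs_exp]
      have h1 := mul_le_mul_of_nonneg_right (abs_residual_le hy')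
        (Real.exp_pos (approxS y)).le
      have h2 : 0 ≤ 2e-9 * y * (Real.exp (approxS y) * approxF y) :=
        mul_nonneg (mul_nonneg (by norm_num) hy'.1)
          (mul_nonneg (Real.exp_pos _).le (approxF_nonneg hy'))
      linarith) hx
  rw [Real.norm_eq_abs] at h
  have e : approxU x - Real.exp (-approxS x)
      = (approxU x * Real.exp (approxS x) - 1) * Real.exp (-approxS x) := by
    rw [sub_mul, mul_assoc, ← Real.exp_add]; simp
  rw [e, abs_mul, Real.abs_exp]
  have h2 := mul_le_mul_of_nonneg_right h (Real.exp_pos (-approxS x)).le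
  rw [mul_assoc, ← Real.exp_add, add_neg_cancel, Real.exp_zero, mul_one] at h2
  refine h2.trans ?_
  have := hx.2
  linarith

variable {F p u : ℝ → ℝ}

/-- Both S and `approxS` satisfy S''' = exp(-S), the latter up to 9e-9, so Grönwall applies to their
difference with ε = 9e-9. -/
theorem IsFlow.enclosure (h : IsFlow F p u) (h1 : u 0 = 1) : ∃ S : ℝ → ℝ,
    (∀ x, 0 ≤ x → u x = Real.exp (-S x)) ∧ ∀ x ∈ Icc (0 : ℝ) (9 / 2),
      |S x - approxS x| ≤ 9e-9 * (Real.exp x - 1) ∧ |F x - approxF x| ≤ 9e-9 * (Real.exp x - 1) ∧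
      |p x - approxP x| ≤ 9e-9 * (Real.exp x - 1) ∧ |u x - approxU x| ≤ 9e-9 * Real.exp x := by
  obtain ⟨S, S0, hS, hu, hS0⟩ := h.exists_integral_nonneg h1
  have hb : ∀ x ∈ Icc (0 : ℝ) (9 / 2), |u x - approxU x| ≤ |S x - approxS x| + 9e-9 := by
    intro x hx
    have e1 := abs_exp_neg_sub_exp_neg_le (hS0 x hx.1) (approxS_nonneg hx)
    have e2 := abs_approxU_sub_exp_le hx
    rw [hu x hx.1]
    simp only [abs_le] at *
    constructor <;> linarith
  have key := fun x hx => abs_le_of_third_deriv (X := 9 / 2) (ε := 9e-9) (x := x)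
    (fun y hy => (hS y hy.1).sub (hasDerivAt_approxS y).hasDerivWithinAt)
    (fun y hy => (h.hF y hy.1).sub (hasDerivAt_approxF y).hasDerivWithinAt)
    (fun y hy => (h.hp y hy.1).sub (hasDerivAt_approxP y).hasDerivWithinAt)
    (by simp [S0, approxS_zero]) (by simp [h.F_zero, approxF_zero])
    (by simp [h.p_zero, approxP_zero]) (by norm_num) hb hx
  refine ⟨S, hu, fun x hx => ?_⟩
  obtain ⟨k0, k1, k2⟩ := key x hx
  simp only [Pi.sub_apply] at k0 k1 k2
  exact ⟨k0, k1, k2, by linarith [hb x hx]⟩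

theorem exp_five_halves_le : Real.exp (5 / 2) ≤ 21 := by
  calc Real.exp (5 / 2) ≤ Real.exp 3 := Real.exp_le_exp.2 (by norm_num)
    _ = Real.exp 1 ^ 3 := by rw [← Real.exp_nat_mul]; norm_num
    _ ≤ 2.72 ^ 3 := by
      have := Real.exp_one_lt_d9
      gcongr
      linarith
    _ ≤ 21 := by norm_num

theorem exp_nine_halves_le : Real.exp (9 / 2) ≤ 150 := by
  calc Real.exp (9 / 2) ≤ Real.exp 5 := Real.exp_le_exp.2 (by norm_num)
    _ = Real.exp 1 ^ 5 := by rw [← Real.exp_nat_mul]; norm_num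
    _ ≤ 2.72 ^ 5 := by
      have := Real.exp_one_lt_d9
      gcongr
      linarith
    _ ≤ 150 := by norm_num

theorem F₀near_eq_eval (x : ℝ) : F₀near x = eval nearCoeff x / nearDenom := by
  simp only [F₀near, polyP, Fin.sum_univ_succ, pCoeff, nearCoeff, nearDenom, eval]
  simp
  ring

theorem hasDerivAt_F₀near (x : ℝ) :
    HasDerivAt F₀near (eval (derivCoeff nearCoeff) x / nearDenom) x := by
  rw [funext F₀near_eq_eval]
  exact (hasDerivAt_eval _ x).div_const _

theorem abs_div_sub_div_le {a b m n : ℝ} (hm : 0 < m) (hn : 0 < n)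
    (h : 10 ^ 7 * |m * a - n * b| ≤ 3 * (m * n)) : |b / m - a / n| ≤ 3e-7 := by
  have e : b / m - a / n = -((m * a - n * b) / (m * n)) := by field_simp; ring
  rw [e, abs_neg, abs_div, abs_of_pos (mul_pos hm hn), div_le_iff₀ (mul_pos hm hn)]
  linarith

theorem nearDenom_pos : (0 : ℝ) < nearDenom := by
  have : 0 < nearDenom := by decide +kernel
  exact_mod_cast this

theorem abs_approx_sub_near_le {x : ℝ} (hx : x ∈ Icc (0 : ℝ) (5 / 2)) :
    |approxF x - eval nearCoeff x / nearDenom| ≤ 3e-7 ∧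
    |approxP x - eval (derivCoeff nearCoeff) x / nearDenom| ≤ 3e-7 ∧
    |approxU x - eval (derivCoeff (derivCoeff nearCoeff)) x / nearDenom| ≤ 3e-7 := by
  have hx' : x ∈ Icc (0 : ℝ) ((5 : ℤ) / (2 : ℤ)) := by simpa using hx
  have h0 := abs_eval_le (by norm_num) (by norm_num) (by norm_num) difference_test_zero hx'
  have h1 := abs_eval_le (by norm_num) (by norm_num) (by norm_num) difference_test_one hx'
  have h2 := abs_eval_le (by norm_num) (by norm_num) (by norm_num) difference_test_two hx'
  have e1 : derivCoeff differenceCoeff = add (smul (6 * 10 ^ 34) (derivCoeff nearCoeff))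
      (smul (-nearDenom) (derivCoeff (derivCoeff integralCoeff))) := by decide +kernel
  have e2 : derivCoeff (derivCoeff differenceCoeff) = add (smul (6 * 10 ^ 34) (derivCoeff (derivCoeff nearCoeff)))
      (smul (-nearDenom) (derivCoeff (derivCoeff (derivCoeff integralCoeff)))) := by decide +kernel
  rw [differenceCoeff, eval_add, eval_smul, eval_smul] at h0
  rw [e1, eval_add, eval_smul, eval_smul] at h1
  rw [e2, eval_add, eval_smul, eval_smul] at h2
  push_cast at h0 h1 h2
  refine ⟨abs_div_sub_div_le (by positivity) nearDenom_pos ?_,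
    abs_div_sub_div_le (by positivity) nearDenom_pos ?_,
    abs_div_sub_div_le (by positivity) nearDenom_pos ?_⟩
  · rw [sub_eq_add_neg, ← neg_mul]; norm_num1 at *; assumption
  · rw [sub_eq_add_neg, ← neg_mul]; norm_num1 at *; assumption
  · rw [sub_eq_add_neg, ← neg_mul]; norm_num1 at *; assumption

/-- The enclosure error 9e-9 · 21 and the certified difference 3e-7 add up to less than 1e-6. -/
theorem IsFlow.near_bounds (h : IsFlow F p u) (h1 : u 0 = 1) (a b c : ℝ) {x : ℝ}
    (hx : x ∈ Icc (0 : ℝ) (5 / 2)) :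
    |F x - F₀ a b c x| ≤ 1e-6 ∧
    |derivWithin (fun y => F y - F₀ a b c y) (Icc 0 (5 / 2)) x| ≤ 1e-6 ∧
    |iteratedDerivWithin 2 (fun y => F y - F₀ a b c y) (Icc 0 (5 / 2)) x| ≤ 1e-6 := by
  obtain ⟨S, -, hS⟩ := h.enclosure h1
  obtain ⟨-, k0, k1, k2⟩ := hS x ⟨hx.1, hx.2.trans (by norm_num)⟩
  obtain ⟨l0, l1, l2⟩ := abs_approx_sub_near_le hx
  have hexp : Real.exp x ≤ 21 := (Real.exp_le_exp.2 hx.2).trans exp_five_halves_le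
  have hus : UniqueDiffOn ℝ (Icc (0 : ℝ) (5 / 2)) := uniqueDiffOn_Icc (by norm_num)
  have hE : ∀ y ∈ Icc (0 : ℝ) (5 / 2), F y - F₀ a b c y = F y - F₀near y := fun y hy => by
    rw [F₀, if_pos hy.2]
  have d0 : ∀ y ∈ Icc (0 : ℝ) (5 / 2), HasDerivWithinAt (fun y => F y - F₀ a b c y)
      (p y - eval (derivCoeff nearCoeff) y / nearDenom) (Icc 0 (5 / 2)) y := fun y hy =>
    (((h.hF y hy.1).mono Icc_subset_Ici_self).sub
      (hasDerivAt_F₀near y).hasDerivWithinAt).congr hE (hE y hy)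
  have d1 : ∀ y ∈ Icc (0 : ℝ) (5 / 2),
      HasDerivWithinAt (fun y => p y - eval (derivCoeff nearCoeff) y / nearDenom)
      (u y - eval (derivCoeff (derivCoeff nearCoeff)) y / nearDenom) (Icc 0 (5 / 2)) y := fun y hy =>
    ((h.hp y hy.1).mono Icc_subset_Ici_self).sub
      ((hasDerivAt_eval _ y).div_const _).hasDerivWithinAt
  rw [hE x hx, (d0 x hx).derivWithin (hus x hx),
    iteratedDerivWithin_two_of_hasDerivWithinAt hus d0 d1 hx, F₀near_eq_eval]
  simp only [abs_le] at *
  refine ⟨⟨?_, ?_⟩, ⟨?_, ?_⟩, ⟨?_, ?_⟩⟩ <;> linarith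

theorem approx_nine_halves : |approxS (9 / 2) - 10.805754| ≤ 1e-6 ∧
    |approxF (9 / 2) - 5.882918| ≤ 1e-6 ∧ |approxP (9 / 2) - 1.655187| ≤ 1e-6 ∧
    |approxU (9 / 2) - 2.028e-5| ≤ 1e-6 := by
  refine ⟨?_, ?_, ?_, ?_⟩
  all_goals
    simp only [approxS, approxF, approxP, approxU, integralCoeff, derivCoeff, derivAux, eval]
    norm_num [abs_le]

/-- The rounding 1e-6 and the enclosure error 9e-9 · 150 add up to less than 3e-6. At 9/2, F'' is
already so small that the tail corrections to the asymptotic constants are a few 1e-6 at most. -/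
theorem IsFlow.nine_halves_bounds (h : IsFlow F p u) (h1 : u 0 = 1) :
    (∃ v, u (9 / 2) = Real.exp (-v) ∧ |v - 10.805754| ≤ 3e-6) ∧
    |F (9 / 2) - 5.882918| ≤ 3e-6 ∧ |p (9 / 2) - 1.655187| ≤ 3e-6 ∧ u (9 / 2) ≤ 2.3e-5 := by
  obtain ⟨S, hu, hS⟩ := h.enclosure h1
  obtain ⟨k0, k1, k2, k3⟩ := hS (9 / 2) (right_mem_Icc.2 (by norm_num))
  obtain ⟨l0, l1, l2, l3⟩ := approx_nine_halves
  have hexp := exp_nine_halves_le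
  simp only [abs_le] at *
  refine ⟨⟨S (9 / 2), hu _ (by norm_num), ?_, ?_⟩, ⟨?_, ?_⟩, ⟨?_, ?_⟩, ?_⟩ <;> linarith

end Enclosure

/-! ### Behaviour of the solution at infinity -/

/-- `F` is asymptotic to `a x + b`, and `F'' = C exp (-(a x + b)² / (2 a) + G)` with `G → 0`. -/
structure IsAsymptotic (F p u G : ℝ → ℝ) (a b C : ℝ) : Prop where
  hG : ∀ x, 0 ≤ x → HasDerivWithinAt G (-(F x - (a * x + b))) (Ici 0) x
  hu : ∀ x, 0 ≤ x → u x = C * Real.exp (-((a * x + b) ^ 2 / (2 * a)) + G x)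
  tendsto_p : Tendsto p atTop (𝓝 a)
  tendsto_F : Tendsto (fun x => F x - (a * x + b)) atTop (𝓝 0)
  tendsto_G : Tendsto G atTop (𝓝 0)

/-- Here y is log C and k is 2a³. Squaring turns C = c a √(2a) into C² = c² · 2a³, free of roots;
exp(2y) is enclosed by Taylor sums at the two ends of the range of 2y. -/
theorem exp_sq_bounds {y c k : ℝ} (hc : c = 0.2337260) (hk : 9.06918 ≤ k ∧ k ≤ 9.06938)
    (hy : -0.35120 ≤ y ∧ y ≤ -0.35109) :
    (c - 5e-5) ^ 2 * k ≤ Real.exp y ^ 2 ∧ Real.exp y ^ 2 ≤ (c + 5e-5) ^ 2 * k := by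
  have e : Real.exp y ^ 2 = Real.exp (2 * y) := by rw [← Real.exp_nat_mul]; norm_num
  have h1 := Real.exp_bound (x := -(439 / 625)) (n := 9) (by norm_num [abs_le]) (by norm_num)
  have h2 := Real.exp_bound (x := -(35109 / 50000)) (n := 9) (by norm_num [abs_le]) (by norm_num)
  simp only [Finset.sum_range_succ, Finset.sum_range_zero] at h1 h2
  norm_num [abs_le, Nat.factorial] at h1 h2
  have l : Real.exp (-(439 / 625)) ≤ Real.exp (2 * y) := Real.exp_le_exp.2 (by linarith)
  have r : Real.exp (2 * y) ≤ Real.exp (-(35109 / 50000)) := Real.exp_le_exp.2 (by linarith)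
  rw [e, hc]
  constructor
  · norm_num
    linarith
  · norm_num
    linarith

/-- With m = F(9/2), F ≥ m gives u ≤ -u'/m, so every tail integration costs at most a division by m:
a - p, F - (a x + b) and G are between 0 and u/m, u/m², u/m³. -/
theorem IsFlow.exists_asymptotic {F p u : ℝ → ℝ} (h : IsFlow F p u) (h1 : u 0 = 1) :
    ∃ (G : ℝ → ℝ) (a b C : ℝ), IsAsymptotic F p u G a b C ∧ 0 < C ∧
      (1.655184 ≤ a ∧ a ≤ 1.655194) ∧ (-1.565460 ≤ b ∧ b ≤ -1.565406) ∧
      ((0.2337260 - 5e-5) ^ 2 * (2 * a ^ 3) ≤ C ^ 2 ∧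
        C ^ 2 ≤ (0.2337260 + 5e-5) ^ 2 * (2 * a ^ 3)) := by
  obtain ⟨S, -, hS, hu, -⟩ := h.exists_integral_nonneg h1
  obtain ⟨⟨v, hv, hv'⟩, hF1, hp1, hu1⟩ := h.nine_halves_bounds h1
  have h0 : 0 ≤ u 0 := by rw [h1]; exact zero_le_one
  have hu0 : ∀ x, 0 ≤ x → 0 < u x := fun x hx => by rw [hu x hx]; exact Real.exp_pos _
  set m := F (9 / 2) with hm
  rw [abs_le] at hF1 hp1 hv'
  have hm5 : 5.8829 ≤ m := by linarith [hF1.1]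
  have hm0 : 0 < m := by linarith
  have hle : ∀ x : ℝ, 9 / 2 ≤ x → 0 ≤ x := fun x hx => by linarith
  have hFm : ∀ x, 9 / 2 ≤ x → m ≤ F x := fun x hx =>
    h.monotone_F h0 (mem_Ici.2 (by norm_num)) (hle x hx) hx
  have sub : Ici (9 / 2 : ℝ) ⊆ Ici 0 := Ici_subset_Ici.2 (by norm_num)
  have du : ∀ k : ℝ, ∀ x, 9 / 2 ≤ x →
      HasDerivWithinAt (fun x => u x / k) (-(F x * u x / k)) (Ici (9 / 2)) x := fun k x hx => by
    rw [← neg_div]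
    exact ((h.hu x (hle x hx)).mono sub).div_const k
  have hu_lim : Tendsto u atTop (𝓝 0) := by
    -- The product u exp(m x) decreases, since u' = -F u ≤ -m u.
    have d : ∀ x, 9 / 2 ≤ x → HasDerivWithinAt (fun x => u x * Real.exp (m * x))
        (-(F x * u x) * Real.exp (m * x) + u x * (Real.exp (m * x) * m)) (Ici (9 / 2)) x := by
      intro x hx
      refine (((h.hu x (hle x hx)).mono sub).mul
        ((hasDerivAt_id x).const_mul m).exp.hasDerivWithinAt).congr_deriv ?_
      simp
    have anti := antitoneOn_Ici_of_hasDerivWithinAt d fun x hx => by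
      have := mul_nonneg (mul_nonneg (sub_nonneg.2 (hFm x hx)) (hu0 x (hle x hx)).le)
        (Real.exp_pos (m * x)).le
      linarith
    have hlim : Tendsto (fun x => u (9 / 2) * Real.exp (m * (9 / 2)) * Real.exp (-(m * x))) atTop
        (𝓝 0) := by
      have := (Real.tendsto_exp_neg_atTop_nhds_zero.comp
        (tendsto_id.const_mul_atTop hm0)).const_mul (u (9 / 2) * Real.exp (m * (9 / 2)))
      simpa using this
    refine tendsto_of_tendsto_of_tendsto_of_le_of_le' tendsto_const_nhds hlim
      ((eventually_ge_atTop 0).mono fun x hx => (hu0 x hx).le)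
      ((eventually_ge_atTop (9 / 2)).mono fun x hx => ?_)
    have := mul_le_mul_of_nonneg_right (anti self_mem_Ici hx hx) (Real.exp_pos (-(m * x))).le
    simp only [mul_assoc] at this ⊢
    rwa [← Real.exp_add (m * x), add_neg_cancel, Real.exp_zero, mul_one] at this
  have lim : ∀ k : ℝ, Tendsto (fun x => u x / k) atTop (𝓝 0) := fun k => by
    simpa using hu_lim.div_const k
  -- the limit of the first derivative
  obtain ⟨a', ha'⟩ := exists_tendsto_of_tail (f := fun x => -p x) (k := u) (x₀ := 9 / 2)
    (fun x hx => ((h.hp x (hle x hx)).mono sub).neg) (du m)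
    (fun x hx => (hu0 x (hle x hx)).le) (fun x hx => by
      rw [le_div_iff₀ hm0]; nlinarith [hFm x hx, hu0 x (hle x hx)]) (lim m)
  obtain ⟨a, rfl⟩ : ∃ a, a' = -a := ⟨-a', by ring⟩
  have pa : Tendsto p atTop (𝓝 a) := by simpa using ha'.neg
  have dA : ∀ x, 9 / 2 ≤ x → HasDerivWithinAt (fun x => a - p x) (-u x) (Ici (9 / 2)) x :=
    fun x hx => ((h.hp x (hle x hx)).mono sub).const_sub a
  have limA : Tendsto (fun x => a - p x) atTop (𝓝 0) := by simpa using pa.const_sub a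
  have hA0 : ∀ x, 9 / 2 ≤ x → 0 ≤ a - p x := fun x hx =>
    tail_nonneg dA (fun x hx => (hu0 x (hle x hx)).le) limA hx
  have hA : ∀ x, 9 / 2 ≤ x → a - p x ≤ u x / m := fun x hx =>
    tail_le dA (du m) (fun x hx => by
      rw [le_div_iff₀ hm0]; nlinarith [hFm x hx, hu0 x (hle x hx)]) limA (lim m) hx
  have step : ∀ k : ℝ, 0 < k → ∀ x, 9 / 2 ≤ x → u x / k ≤ F x * u x / (k * m) := by
    intro k hk x hx
    rw [div_le_div_iff₀ hk (by positivity)]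
    have := mul_le_mul_of_nonneg_left (hFm x hx) (mul_pos hk (hu0 x (hle x hx))).le
    nlinarith
  -- the intercept of the asymptote
  have dF : ∀ x, 9 / 2 ≤ x →
      HasDerivWithinAt (fun x => F x - a * x) (-(a - p x)) (Ici (9 / 2)) x := fun x hx => by
    refine (((h.hF x (hle x hx)).mono sub).sub
      ((hasDerivAt_id x).const_mul a).hasDerivWithinAt).congr_deriv ?_
    ring
  have stepA := fun x hx => (hA x hx).trans (step m hm0 x hx)
  obtain ⟨b, hb⟩ := exists_tendsto_of_tail dF (du (m * m)) hA0 stepA (lim _)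
  have dB : ∀ x, 9 / 2 ≤ x →
      HasDerivWithinAt (fun x => F x - (a * x + b)) (-(a - p x)) (Ici (9 / 2)) x := fun x hx =>
    ((dF x hx).sub_const b).congr (fun y _ => by ring) (by ring)
  have limB : Tendsto (fun x => F x - (a * x + b)) atTop (𝓝 0) := by
    have := hb.sub_const b
    rw [sub_self] at this
    exact this.congr fun x => by ring
  have hB0 : ∀ x, 9 / 2 ≤ x → 0 ≤ F x - (a * x + b) := fun x hx => tail_nonneg dB hA0 limB hx
  have hB : ∀ x, 9 / 2 ≤ x → F x - (a * x + b) ≤ u x / (m * m) := fun x hx =>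
    tail_le dB (du (m * m)) stepA limB (lim _) hx
  -- the logarithm of the second derivative
  have dS : ∀ x, 0 ≤ x → HasDerivWithinAt (fun x => a * x ^ 2 / 2 + b * x - S x)
      (-(F x - (a * x + b))) (Ici 0) x := fun x hx => by
    have := ((((hasDerivAt_pow 2 x).const_mul a).div_const 2).add
      ((hasDerivAt_id x).const_mul b)).hasDerivWithinAt.sub (hS x hx)
    refine this.congr_deriv ?_
    simp
    ring
  have dS' : ∀ x, 9 / 2 ≤ x → HasDerivWithinAt (fun x => a * x ^ 2 / 2 + b * x - S x)
      (-(F x - (a * x + b))) (Ici (9 / 2)) x := fun x hx => (dS x (hle x hx)).mono sub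
  have stepB := fun x hx => (hB x hx).trans (step (m * m) (by positivity) x hx)
  obtain ⟨l, hl⟩ := exists_tendsto_of_tail dS' (du (m * m * m)) hB0 stepB (lim _)
  have limG : Tendsto (fun x => a * x ^ 2 / 2 + b * x - S x - l) atTop (𝓝 0) := by
    simpa using hl.sub_const l
  have hG0 := tail_nonneg (fun x hx => (dS' x hx).sub_const l) hB0 limG (le_refl (9 / 2))
  have hG := tail_le (fun x hx => (dS' x hx).sub_const l) (du (m * m * m)) stepB limG (lim _)
    (le_refl (9 / 2))
  -- numerical values
  have hA1 := hA _ le_rfl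
  have hA01 := hA0 _ le_rfl
  have hB1 := hB _ le_rfl
  have hB01 := hB0 _ le_rfl
  have hu1' := hu0 (9 / 2) (by norm_num)
  have q1 : u (9 / 2) / m ≤ 3.92e-6 := by rw [div_le_iff₀ hm0]; linarith
  have q2 : u (9 / 2) / (m * m) ≤ 6.7e-7 := by
    rw [div_le_iff₀ (by positivity)]
    have : 5.8829 * 5.8829 ≤ m * m := by gcongr
    linarith
  have q3 : u (9 / 2) / (m * m * m) ≤ 1.2e-7 := by
    rw [div_le_iff₀ (by positivity)]
    have : 5.8829 * 5.8829 * 5.8829 ≤ m * m * m := by gcongr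
    linarith
  have a1 : 1.655184 ≤ a := by linarith
  have a2 : a ≤ 1.655194 := by linarith
  have ha0 : 0 < a := by linarith
  have b1 : -1.565460 ≤ b := by linarith
  have b2 : b ≤ -1.565406 := by linarith
  -- Completing the square in a x²/2 + b x moves b²/(2a) into log C, next to the limit l.
  refine ⟨fun x => a * x ^ 2 / 2 + b * x - S x - l, a, b, Real.exp (l + b ^ 2 / (2 * a)),
    ⟨fun x hx => (dS x hx).sub_const l, fun x hx => ?_, pa, limB, limG⟩, Real.exp_pos _,
    ⟨a1, a2⟩, ⟨b1, b2⟩, ?_⟩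
  · rw [hu x hx, ← Real.exp_add]
    congr 1
    field_simp
    ring
  · have hSv : S (9 / 2) = v := by
      have := (hu (9 / 2) (by norm_num)).symm.trans hv
      linarith [Real.exp_injective this]
    rw [hSv] at hG hG0
    -- With L = 9a/2 + b, log C = L²/(2a) - v - G(9/2), and 0 ≤ G(9/2) ≤ 1.2e-7.
    set L := a * (9 / 2) + b with hL
    have hLt : a * (9 / 2) ^ 2 / 2 + b * (9 / 2) + b ^ 2 / (2 * a) = L ^ 2 / (2 * a) := by
      rw [hL]; field_simp; ring
    have L1 : 5.882914 ≤ L := by linarith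
    have L2 : L ≤ 5.882921 := by linarith
    have t1 : 10.45456 ≤ L ^ 2 / (2 * a) := by
      rw [le_div_iff₀ (by positivity)]
      have : (5.882914 : ℝ) ^ 2 ≤ L ^ 2 := by gcongr
      linarith
    have t2 : L ^ 2 / (2 * a) ≤ 10.45466 := by
      rw [div_le_iff₀ (by positivity)]
      have : L ^ 2 ≤ (5.882921 : ℝ) ^ 2 := by gcongr
      linarith
    refine exp_sq_bounds rfl ⟨?_, ?_⟩ ⟨?_, ?_⟩
    · have : (1.655184 : ℝ) ^ 3 ≤ a ^ 3 := by gcongr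
      norm_num at this ⊢
      linarith
    · have : a ^ 3 ≤ (1.655194 : ℝ) ^ 3 := by gcongr
      norm_num at this ⊢
      linarith
    · linarith
    · linarith

/-! ### The complementary error function -/

theorem integrable_exp_neg_sq : Integrable fun s : ℝ => Real.exp (-s ^ 2) := by
  simpa using integrable_exp_neg_mul_sq one_pos

theorem erfc_eq (z : ℝ) : erfc z = 2 / √Real.pi *
    ((∫ s in Ioi (0 : ℝ), Real.exp (-s ^ 2)) - ∫ s in (0 : ℝ)..z, Real.exp (-s ^ 2)) := by
  rw [erfc, ← intervalIntegral.integral_Ioi_sub_Ioi' integrable_exp_neg_sq.integrableOn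
    integrable_exp_neg_sq.integrableOn]
  ring

theorem hasDerivAt_erfc (z : ℝ) : HasDerivAt erfc (-(2 / √Real.pi * Real.exp (-z ^ 2))) z := by
  have hc : Continuous fun s : ℝ => Real.exp (-s ^ 2) := by fun_prop
  rw [funext erfc_eq]
  refine (((hc.integral_hasStrictDerivAt 0 z).hasDerivAt.const_sub _).const_mul _).congr_deriv ?_
  ring

theorem tendsto_erfc : Tendsto erfc atTop (𝓝 0) := by
  rw [funext erfc_eq]
  have := intervalIntegral_tendsto_integral_Ioi 0
    (integrable_exp_neg_sq.integrableOn (s := Ioi 0)) tendsto_id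
  have := (this.const_sub (∫ s in Ioi (0 : ℝ), Real.exp (-s ^ 2))).const_mul (2 / √Real.pi)
  simpa using this

theorem hasDerivAt_exp_neg_sq (z : ℝ) :
    HasDerivAt (fun z : ℝ => Real.exp (-z ^ 2)) (-(2 * z * Real.exp (-z ^ 2))) z := by
  refine (hasDerivAt_pow 2 z).neg.exp.congr_deriv ?_
  simp
  ring

theorem tendsto_pow_mul_exp_neg_sq (k : ℕ) :
    Tendsto (fun z : ℝ => z ^ k * Real.exp (-z ^ 2)) atTop (𝓝 0) := by
  refine tendsto_of_tendsto_of_tendsto_of_le_of_le' tendsto_const_nhds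
    (Real.tendsto_pow_mul_exp_neg_atTop_nhds_zero k) ?_ ?_
  · filter_upwards [eventually_ge_atTop 0] with z hz
    positivity
  · filter_upwards [eventually_ge_atTop 1] with z hz
    gcongr
    nlinarith

theorem erfc_nonneg (z : ℝ) : 0 ≤ erfc z :=
  tail_nonneg (x₀ := z) (fun x _ => (hasDerivAt_erfc x).hasDerivWithinAt)
    (fun x _ => by positivity) tendsto_erfc le_rfl

/-- For z ≥ 1 the derivative of exp(-z²) dominates the integrand. Only the resulting decay at
infinity is needed. -/
theorem erfc_le {z : ℝ} (hz : 1 ≤ z) : erfc z ≤ 1 / √Real.pi * Real.exp (-z ^ 2) := by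
  refine tail_le (x₀ := 1) (fun x _ => (hasDerivAt_erfc x).hasDerivWithinAt)
    (B := fun z => 1 / √Real.pi * Real.exp (-z ^ 2))
    (κ := fun z => 1 / √Real.pi * (2 * z * Real.exp (-z ^ 2)))
    (fun x _ => ?_) (fun x hx => ?_) tendsto_erfc ?_ hz
  · refine ((hasDerivAt_exp_neg_sq x).const_mul _).hasDerivWithinAt.congr_deriv ?_
    ring
  · have : 0 ≤ 1 / √Real.pi * Real.exp (-x ^ 2) * (2 * (x - 1)) :=
      mul_nonneg (by positivity) (by linarith)
    have e : 2 / √Real.pi = 2 * (1 / √Real.pi) := by ring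
    rw [e]
    linarith
  · have := (tendsto_pow_mul_exp_neg_sq 0).const_mul (1 / √Real.pi)
    simpa using this

theorem tendsto_pow_mul_erfc (k : ℕ) : Tendsto (fun z => z ^ k * erfc z) atTop (𝓝 0) := by
  have h := (tendsto_pow_mul_exp_neg_sq k).const_mul (1 / √Real.pi)
  rw [mul_zero] at h
  refine tendsto_of_tendsto_of_tendsto_of_le_of_le' tendsto_const_nhds h ?_ ?_
  · filter_upwards [eventually_ge_atTop 0] with z hz
    exact mul_nonneg (by positivity) (erfc_nonneg z)
  · filter_upwards [eventually_ge_atTop 1] with z hz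
    have := mul_le_mul_of_nonneg_left (erfc_le hz) (show 0 ≤ z ^ k by positivity)
    linarith

/-! ### The approximation on `[5 / 2, ∞)` -/

/-- `exp (-z²)` times `I₀ (z²)`. -/
noncomputable def firstTerm (z : ℝ) : ℝ := Real.exp (-z ^ 2) - √Real.pi * z * erfc z

/-- The second order contribution to the approximation. -/
noncomputable def secondTerm (z : ℝ) : ℝ :=
  -(2 * √2 * √Real.pi * erfc (√2 * z)) + 3 * √Real.pi * (Real.exp (-z ^ 2) * erfc z)
    - √Real.pi ^ 2 * (z * erfc z * erfc z)

/-- The derivative of `secondTerm`. -/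
noncomputable def secondTermDeriv (z : ℝ) : ℝ :=
  2 * (Real.exp (-z ^ 2) * Real.exp (-z ^ 2)) - 2 * √Real.pi * (z * Real.exp (-z ^ 2) * erfc z)
    - √Real.pi ^ 2 * (erfc z * erfc z)

/-- A multiple of the integral of `firstTerm`. -/
noncomputable def tailTerm (z : ℝ) : ℝ :=
  √Real.pi / 2 * (erfc z + 2 * (z ^ 2 * erfc z)) - z * Real.exp (-z ^ 2)

theorem sqrt_pi_mul_inv : √Real.pi * (2 / √Real.pi) = 2 := by
  have : √Real.pi ≠ 0 := (Real.sqrt_pos.2 Real.pi_pos).ne'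
  field_simp

theorem hasDerivAt_firstTerm (z : ℝ) : HasDerivAt firstTerm (-(√Real.pi * erfc z)) z := by
  refine ((hasDerivAt_exp_neg_sq z).sub
    (((hasDerivAt_id z).const_mul √Real.pi).mul (hasDerivAt_erfc z))).congr_deriv ?_
  simp only [id]
  linear_combination (z * Real.exp (-z ^ 2)) * sqrt_pi_mul_inv

theorem hasDerivAt_sqrt_pi_mul_erfc (z : ℝ) :
    HasDerivAt (fun z => √Real.pi * erfc z) (-(2 * Real.exp (-z ^ 2))) z := by
  refine ((hasDerivAt_erfc z).const_mul √Real.pi).congr_deriv ?_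
  linear_combination (-Real.exp (-z ^ 2)) * sqrt_pi_mul_inv

theorem hasDerivAt_tailTerm (z : ℝ) : HasDerivAt tailTerm (-(2 * firstTerm z)) z := by
  refine ((((hasDerivAt_erfc z).add (((hasDerivAt_pow 2 z).mul
    (hasDerivAt_erfc z)).const_mul 2)).const_mul (√Real.pi / 2)).sub
    ((hasDerivAt_id z).mul (hasDerivAt_exp_neg_sq z))).congr_deriv ?_
  simp only [id, firstTerm]
  push_cast
  linear_combination (-Real.exp (-z ^ 2) / 2 * (1 + 2 * z ^ 2)) * sqrt_pi_mul_inv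

theorem hasDerivAt_secondTerm (z : ℝ) : HasDerivAt secondTerm (secondTermDeriv z) z := by
  have h2 : √2 * √2 = (2 : ℝ) := Real.mul_self_sqrt (by norm_num)
  have h1 : HasDerivAt (fun z => erfc (√2 * z))
      (-(2 / √Real.pi * (Real.exp (-z ^ 2) * Real.exp (-z ^ 2))) * √2) z := by
    have := (hasDerivAt_erfc (√2 * z)).comp z ((hasDerivAt_id z).const_mul √2)
    refine this.congr_deriv ?_
    have e : -(√2 * z) ^ 2 = -z ^ 2 + -z ^ 2 := by linear_combination (-z ^ 2) * h2
    rw [e, Real.exp_add, mul_one]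
  refine (((h1.const_mul (2 * √2 * √Real.pi)).neg.add
    (((hasDerivAt_exp_neg_sq z).mul (hasDerivAt_erfc z)).const_mul (3 * √Real.pi))).sub
    ((((hasDerivAt_id z).mul (hasDerivAt_erfc z)).mul (hasDerivAt_erfc z)).const_mul
      (√Real.pi ^ 2))).congr_deriv ?_
  simp only [id, secondTermDeriv, Pi.mul_apply]
  linear_combination (2 * √2 * √2 * (Real.exp (-z ^ 2) * Real.exp (-z ^ 2))
    - 3 * (Real.exp (-z ^ 2) * Real.exp (-z ^ 2))
    + 2 * √Real.pi * z * erfc z * Real.exp (-z ^ 2)) * sqrt_pi_mul_inv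
    + 4 * (Real.exp (-z ^ 2) * Real.exp (-z ^ 2)) * h2

/-- This product form lets the second derivative of `F₀far` factor as C g (1 + c `tailTerm`). -/
theorem hasDerivAt_secondTermDeriv (z : ℝ) :
    HasDerivAt secondTermDeriv (4 * Real.exp (-z ^ 2) * tailTerm z) z := by
  have d := hasDerivAt_exp_neg_sq z
  have e := hasDerivAt_erfc z
  refine ((((d.mul d).const_mul 2).sub
    ((((hasDerivAt_id z).mul d).mul e).const_mul (2 * √Real.pi))).sub
    ((e.mul e).const_mul (√Real.pi ^ 2))).congr_deriv ?_
  simp only [id, tailTerm, Pi.mul_apply]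
  linear_combination (2 * z * Real.exp (-z ^ 2) * Real.exp (-z ^ 2)
    + 2 * √Real.pi * erfc z * Real.exp (-z ^ 2)) * sqrt_pi_mul_inv

theorem tendsto_firstTerm : Tendsto firstTerm atTop (𝓝 0) := by
  have := (tendsto_pow_mul_exp_neg_sq 0).sub ((tendsto_pow_mul_erfc 1).const_mul √Real.pi)
  simp only [mul_zero, sub_zero, pow_zero, pow_one, one_mul, ← mul_assoc] at this
  exact this

theorem tendsto_tailTerm : Tendsto tailTerm atTop (𝓝 0) := by
  have := ((tendsto_erfc.add ((tendsto_pow_mul_erfc 2).const_mul 2)).const_mul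
    (√Real.pi / 2)).sub (tendsto_pow_mul_exp_neg_sq 1)
  simp only [mul_zero, add_zero, sub_zero, pow_one] at this
  exact this

theorem tendsto_secondTerm : Tendsto secondTerm atTop (𝓝 0) := by
  have h0 : Tendsto (fun z : ℝ => √2 * z) atTop atTop :=
    tendsto_id.const_mul_atTop (by positivity)
  have := (((tendsto_erfc.comp h0).const_mul (2 * √2 * √Real.pi)).neg.add
    (((tendsto_pow_mul_exp_neg_sq 0).mul tendsto_erfc).const_mul (3 * √Real.pi))).sub
    (((tendsto_pow_mul_erfc 1).mul tendsto_erfc).const_mul (√Real.pi ^ 2))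
  simp only [mul_zero, neg_zero, add_zero, sub_zero, pow_zero, pow_one, one_mul] at this
  exact this

theorem tendsto_secondTermDeriv : Tendsto secondTermDeriv atTop (𝓝 0) := by
  have h0 := tendsto_pow_mul_exp_neg_sq 0
  have := (((h0.mul h0).const_mul 2).sub
    (((tendsto_pow_mul_exp_neg_sq 1).mul tendsto_erfc).const_mul (2 * √Real.pi))).sub
    ((tendsto_erfc.mul tendsto_erfc).const_mul (√Real.pi ^ 2))
  simp only [mul_zero, sub_zero, pow_zero, pow_one, one_mul] at this
  exact this

/-- The square root of `tVar`, as long as it is nonnegative. -/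
noncomputable def sigma (a b x : ℝ) : ℝ := (a * x + b) / √(2 * a)

theorem sqrt_two_mul_sq {a : ℝ} (ha : 0 < a) : √(2 * a) ^ 2 = 2 * a :=
  Real.sq_sqrt (by positivity)

theorem sigma_sq {a : ℝ} (ha : 0 < a) (b x : ℝ) :
    sigma a b x ^ 2 = (a * x + b) ^ 2 / (2 * a) := by
  rw [sigma, div_pow, sqrt_two_mul_sq ha]

theorem tVar_eq {a : ℝ} (ha : 0 < a) (b x : ℝ) : tVar a b x = sigma a b x ^ 2 := by
  rw [sigma_sq ha, tVar]
  field_simp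

theorem hasDerivAt_sigma {a : ℝ} (ha : 0 < a) (b x : ℝ) :
    HasDerivAt (sigma a b) (√(2 * a) / 2) x := by
  refine ((((hasDerivAt_id x).const_mul a).add_const b).div_const √(2 * a)).congr_deriv ?_
  have h : √(2 * a) ≠ 0 := (Real.sqrt_pos.2 (by positivity)).ne'
  rw [div_eq_div_iff h two_ne_zero]
  linear_combination -(sqrt_two_mul_sq ha)

theorem tendsto_sigma {a : ℝ} (ha : 0 < a) (b : ℝ) : Tendsto (sigma a b) atTop atTop :=
  (tendsto_atTop_add_const_right _ b (tendsto_id.const_mul_atTop ha)).atTop_div_const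
    (Real.sqrt_pos.2 (by positivity))

theorem I₀_sq {z : ℝ} (hz : 0 ≤ z) :
    I₀ (z ^ 2) = 1 - √Real.pi * z * Real.exp (z ^ 2) * erfc z := by
  rw [I₀, Real.sqrt_mul Real.pi_pos.le, Real.sqrt_sq hz]

theorem J₀_sq {z : ℝ} (hz : 0 ≤ z) : J₀ (z ^ 2)
    = 1 - √2 * √Real.pi * z * (Real.exp (z ^ 2) * Real.exp (z ^ 2)) * erfc (√2 * z) := by
  rw [J₀, Real.sqrt_mul (by positivity), Real.sqrt_mul (by positivity),
    Real.sqrt_mul (by positivity), Real.sqrt_sq hz, ← Real.exp_add, ← two_mul]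

/-- In the variable σ = √t the growing exponentials in `I₀` and `J₀` cancel against exp(-t) and
exp(-2t), leaving functions smooth on the whole line. -/
theorem F₀far_eq {a b c x : ℝ} (ha : 0 < a) (hx : 0 < a * x + b) :
    F₀far a b c x = a * x + b + (c * √(2 * a) * firstTerm (sigma a b x)
      + √(2 * a) / 2 * c ^ 2 * secondTerm (sigma a b x)) := by
  have hw : 0 < √(2 * a) := Real.sqrt_pos.2 (by positivity)
  have hz : 0 < sigma a b x := div_pos hx hw
  rw [F₀far, tVar_eq ha]
  set z := sigma a b x
  have e1 : √(a / (2 * z ^ 2)) = √(2 * a) / (2 * z) := by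
    rw [show a / (2 * z ^ 2) = 2 * a / (2 * z) ^ 2 by field_simp,
      Real.sqrt_div' _ (by positivity),
      Real.sqrt_sq (by positivity)]
  have e2 : Real.exp (-2 * z ^ 2) = Real.exp (-z ^ 2) * Real.exp (-z ^ 2) := by
    rw [← Real.exp_add]; ring_nf
  have e3 : Real.exp (z ^ 2) * Real.exp (-z ^ 2) = 1 := by
    rw [← Real.exp_add]; simp
  rw [e1, q₀, I₀_sq hz.le, J₀_sq hz.le, Real.sqrt_sq hz.le, e2, firstTerm, secondTerm]
  field_simp
  -- With exp(z²) replaced by the inverse of exp(-z²), the claim is a rational identity in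
  -- independent symbols.
  generalize Real.exp (z ^ 2) = X at *
  generalize Real.exp (-z ^ 2) = Y at *
  generalize erfc (√2 * z) = R at *
  generalize erfc z = T at *
  generalize √Real.pi = P at *
  generalize √2 = Q at *
  have hX : X = 1 / Y := by
    have : Y ≠ 0 := right_ne_zero_of_mul_eq_one e3
    field_simp; exact e3
  have hY : Y ≠ 0 := right_ne_zero_of_mul_eq_one e3
  subst hX
  field_simp
  ring

section FarDerivatives

variable {a b c x₀ x : ℝ}

theorem pos_of_le (ha : 0 < a) (h₀ : 0 < a * x₀ + b) (hx : x₀ ≤ x) : 0 < a * x + b := by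
  nlinarith

/-- The derivative of `F₀far`. -/
noncomputable def farDeriv (a b c x : ℝ) : ℝ :=
  a + (-(c * a * (√Real.pi * erfc (sigma a b x))) + a / 2 * c ^ 2 * secondTermDeriv (sigma a b x))

/-- The second derivative of `F₀far`. -/
noncomputable def farDerivTwo (a b c x : ℝ) : ℝ :=
  c * a * √(2 * a) * Real.exp (-((a * x + b) ^ 2 / (2 * a))) * (1 + c * tailTerm (sigma a b x))

/-- With C = c a √(2a), the functions c a √π `erfc`, c √(2a) `firstTerm` and c `tailTerm` of σ are
the successive tail integrals of C times the Gaussian, hence first order approximations of a - p, F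
- (a x + b) and G. This and the next two lemmas supply the links. -/
theorem hasDerivAt_firstTerm_sigma (ha : 0 < a) (b c x : ℝ) :
    HasDerivAt (fun x => c * √(2 * a) * firstTerm (sigma a b x))
      (-(c * a * (√Real.pi * erfc (sigma a b x)))) x := by
  refine (((hasDerivAt_firstTerm _).comp x (hasDerivAt_sigma ha b x)).const_mul _).congr_deriv ?_
  linear_combination (-c * √Real.pi * erfc (sigma a b x) / 2) * sqrt_two_mul_sq ha

theorem hasDerivAt_erfc_sigma (ha : 0 < a) (b c x : ℝ) :
    HasDerivAt (fun x => c * a * (√Real.pi * erfc (sigma a b x)))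
      (-(c * a * √(2 * a) * Real.exp (-((a * x + b) ^ 2 / (2 * a))))) x := by
  refine (((hasDerivAt_sqrt_pi_mul_erfc _).comp x
    (hasDerivAt_sigma ha b x)).const_mul _).congr_deriv ?_
  rw [sigma_sq ha]
  ring

theorem hasDerivAt_tailTerm_sigma (ha : 0 < a) (b c x : ℝ) :
    HasDerivAt (fun x => c * tailTerm (sigma a b x))
      (-(c * √(2 * a) * firstTerm (sigma a b x))) x := by
  refine (((hasDerivAt_tailTerm _).comp x (hasDerivAt_sigma ha b x)).const_mul _).congr_deriv ?_
  ring

theorem hasDerivWithinAt_F₀far (ha : 0 < a) (h₀ : 0 < a * x₀ + b) (c : ℝ) (hx : x₀ ≤ x) :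
    HasDerivWithinAt (F₀far a b c) (farDeriv a b c x) (Ici x₀) x := by
  have h : HasDerivAt (fun x => a * x + b + (c * √(2 * a) * firstTerm (sigma a b x)
      + √(2 * a) / 2 * c ^ 2 * secondTerm (sigma a b x))) (farDeriv a b c x) x := by
    refine ((((hasDerivAt_id x).const_mul a).add_const b).add
      ((hasDerivAt_firstTerm_sigma ha b c x).add (((hasDerivAt_secondTerm _).comp x
      (hasDerivAt_sigma ha b x)).const_mul (√(2 * a) / 2 * c ^ 2)))).congr_deriv ?_
    rw [farDeriv]
    linear_combination (c ^ 2 * secondTermDeriv (sigma a b x) / 4) * sqrt_two_mul_sq ha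
  exact h.hasDerivWithinAt.congr (fun y hy => F₀far_eq ha (pos_of_le ha h₀ hy))
    (F₀far_eq ha (pos_of_le ha h₀ hx))

theorem hasDerivAt_farDeriv (ha : 0 < a) (b c x : ℝ) :
    HasDerivAt (farDeriv a b c) (farDerivTwo a b c x) x := by
  refine (((hasDerivAt_erfc_sigma ha b c x).neg.add (((hasDerivAt_secondTermDeriv _).comp x
    (hasDerivAt_sigma ha b x)).const_mul (a / 2 * c ^ 2))).const_add a).congr_deriv ?_
  rw [farDerivTwo, sigma_sq ha]
  ring

theorem tendsto_F₀far_sub (ha : 0 < a) (b c : ℝ) :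
    Tendsto (fun x => F₀far a b c x - (a * x + b)) atTop (𝓝 0) := by
  have h := ((tendsto_firstTerm.comp (tendsto_sigma ha b)).const_mul (c * √(2 * a))).add
    ((tendsto_secondTerm.comp (tendsto_sigma ha b)).const_mul (√(2 * a) / 2 * c ^ 2))
  simp only [mul_zero, add_zero] at h
  refine h.congr' ?_
  filter_upwards [(tendsto_atTop_add_const_right _ b
    (tendsto_id.const_mul_atTop ha)).eventually_gt_atTop 0] with x hx
  simp only [id] at hx
  rw [F₀far_eq ha hx]
  simp

theorem tendsto_farDeriv (ha : 0 < a) (b c : ℝ) : Tendsto (farDeriv a b c) atTop (𝓝 a) := by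
  have h := ((((tendsto_erfc.comp (tendsto_sigma ha b)).const_mul √Real.pi).const_mul
    (c * a)).neg.add ((tendsto_secondTermDeriv.comp (tendsto_sigma ha b)).const_mul
    (a / 2 * c ^ 2))).const_add a
  simp only [mul_zero, neg_zero, add_zero] at h
  exact h

theorem tendsto_tailTerm_sigma (ha : 0 < a) (b c : ℝ) :
    Tendsto (fun x => c * tailTerm (sigma a b x)) atTop (𝓝 0) := by
  simpa using (tendsto_tailTerm.comp (tendsto_sigma ha b)).const_mul c

end FarDerivatives

/-! ### Gaussian tail bounds -/

section Tails

variable {a b : ℝ}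

/-- The Gaussian weight. -/
noncomputable def gauss (a b x : ℝ) : ℝ := Real.exp (-((a * x + b) ^ 2 / (2 * a)))

theorem gauss_pos (a b x : ℝ) : 0 < gauss a b x := Real.exp_pos _

theorem hasDerivAt_gauss (ha : 0 < a) (b x : ℝ) :
    HasDerivAt (gauss a b) (-((a * x + b) * gauss a b x)) x := by
  have h := ((((((hasDerivAt_id x).const_mul a).add_const b).pow 2).div_const (2 * a)).neg).exp
  refine h.congr_deriv ?_
  have e : Real.exp ((-fun x => ((fun x => a * id x + b) ^ 2) x / (2 * a)) x) = gauss a b x := rfl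
  rw [e]
  simp only [id]
  field_simp
  push_cast
  ring

theorem hasDerivAt_inv_linear {x : ℝ} (hx : 0 < a * x + b) :
    HasDerivAt (fun x => (a * x + b)⁻¹) (-(a * (a * x + b)⁻¹ ^ 2)) x := by
  refine ((((hasDerivAt_id x).const_mul a).add_const b).inv hx.ne').congr_deriv ?_
  simp only [id]
  field_simp

theorem tendsto_gauss (ha : 0 < a) (b : ℝ) : Tendsto (gauss a b) atTop (𝓝 0) := by
  have := (tendsto_pow_mul_exp_neg_sq 0).comp (tendsto_sigma ha b)
  simp only [pow_zero, one_mul, Function.comp_def, sigma_sq ha] at this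
  exact this

theorem tendsto_inv_linear (ha : 0 < a) (b : ℝ) :
    Tendsto (fun x => (a * x + b)⁻¹) atTop (𝓝 0) :=
  (tendsto_atTop_add_const_right _ b (tendsto_id.const_mul_atTop ha)).inv_tendsto_atTop

/-- Upper bound for the integral of `gauss`. -/
noncomputable def tailOne (a b x : ℝ) : ℝ := 2 / (9 * √a) *
  (gauss a b x * (1 + 3 * a * (a * x + b)⁻¹ ^ 2 + 6 * a ^ 2 * (a * x + b)⁻¹ ^ 4))

/-- Upper bound for the twofold integral of `gauss`. -/
noncomputable def tailTwo (a b x : ℝ) : ℝ := 2 / (9 * √a) *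
  (gauss a b x * ((a * x + b)⁻¹ + 2 * a * (a * x + b)⁻¹ ^ 3))

/-- Upper bound for the threefold integral of `gauss`. -/
noncomputable def tailThree (a b x : ℝ) : ℝ := 2 / (9 * √a) *
  (gauss a b x * (a * x + b)⁻¹ ^ 2)

theorem hasDerivAt_tailThree (ha : 0 < a) {x : ℝ} (hx : 0 < a * x + b) :
    HasDerivAt (tailThree a b) (-tailTwo a b x) x := by
  refine (((hasDerivAt_gauss ha b x).mul ((hasDerivAt_inv_linear hx).pow 2)).const_mul
    _).congr_deriv ?_
  have e := mul_inv_cancel₀ hx.ne'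
  rw [tailTwo]
  simp only [Pi.pow_apply]
  generalize (a * x + b)⁻¹ = R at *
  linear_combination (-(2 / (9 * √a)) * gauss a b x * R) * e

theorem hasDerivAt_tailTwo (ha : 0 < a) {x : ℝ} (hx : 0 < a * x + b) :
    HasDerivAt (tailTwo a b) (-tailOne a b x) x := by
  have hR := hasDerivAt_inv_linear hx
  refine (((hasDerivAt_gauss ha b x).mul (hR.add ((hR.pow 3).const_mul (2 * a)))).const_mul
    _).congr_deriv ?_
  have e := mul_inv_cancel₀ hx.ne'
  rw [tailOne]
  simp only [Pi.pow_apply, Pi.add_apply]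
  generalize (a * x + b)⁻¹ = R at *
  push_cast
  linear_combination (-(2 / (9 * √a)) * gauss a b x * (1 + 2 * a * R ^ 2)) * e

/-- With s = (a x + b)/√a this says that minus the third derivative of `tailThree` is at least
`gauss`. The constant 9/2, just below the minimum of the quotient over s > 0 (about 4.54), fixes the
prefactor 2/(9√a). -/
theorem sextic_bound (s : ℝ) : 9 / 2 * s ^ 5 ≤ s ^ 6 + 3 * s ^ 4 + 12 * s ^ 2 + 24 := by
  -- The first square matches the difference of the sides down to degree three; the quadratic
  -- remainder is positive.
  nlinarith [sq_nonneg (s ^ 3 - 9 / 4 * s ^ 2 - 33 / 32 * s - 297 / 128), sq_nonneg (s - 24 / 5),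
    sq_nonneg s]

theorem exists_hasDerivAt_tailOne (ha : 0 < a) {x : ℝ} (hx : 0 < a * x + b) :
    ∃ k, HasDerivAt (tailOne a b) (-k) x ∧ gauss a b x ≤ k := by
  have hR := hasDerivAt_inv_linear hx
  have hR0 : 0 < (a * x + b)⁻¹ := inv_pos.2 hx
  have hr : 0 < √a := Real.sqrt_pos.2 ha
  have hr2 : √a ^ 2 = a := Real.sq_sqrt ha.le
  have e := mul_inv_cancel₀ hx.ne'
  refine ⟨_, (((hasDerivAt_gauss ha b x).mul ((((hR.pow 2).const_mul (3 * a)).const_add 1).add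
    ((hR.pow 4).const_mul (6 * a ^ 2)))).const_mul (2 / (9 * √a))).congr_deriv
    (g' := -(2 / (9 * √a) * (gauss a b x * ((a * x + b) + 3 * a * (a * x + b)⁻¹
      + 12 * a ^ 2 * (a * x + b)⁻¹ ^ 3 + 24 * a ^ 3 * (a * x + b)⁻¹ ^ 5)))) ?_, ?_⟩
  · simp only [Pi.pow_apply, Pi.add_apply]
    generalize (a * x + b)⁻¹ = R at *
    push_cast
    linear_combination (-(2 / (9 * √a)) * gauss a b x * (3 * a * R + 6 * a ^ 2 * R ^ 3)) * e
  · have hL := hx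
    have hg := gauss_pos a b x
    have key := sextic_bound ((a * x + b) / √a)
    set L := a * x + b
    have e2 : 2 / (9 * √a) * (L + 3 * a * L⁻¹ + 12 * a ^ 2 * L⁻¹ ^ 3 + 24 * a ^ 3 * L⁻¹ ^ 5)
        = 2 / 9 * (((L / √a) ^ 6 + 3 * (L / √a) ^ 4 + 12 * (L / √a) ^ 2 + 24)
          / (L / √a) ^ 5) := by
      set r := √a
      rw [← hr2]
      field_simp
    have h1 : 1 ≤ 2 / (9 * √a) * (L + 3 * a * L⁻¹ + 12 * a ^ 2 * L⁻¹ ^ 3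
        + 24 * a ^ 3 * L⁻¹ ^ 5) := by
      have : 9 / 2 ≤ ((L / √a) ^ 6 + 3 * (L / √a) ^ 4 + 12 * (L / √a) ^ 2 + 24)
          / (L / √a) ^ 5 := by
        rw [le_div_iff₀ (by positivity)]
        exact key
      rw [e2]
      linarith
    have := mul_le_mul_of_nonneg_left h1 hg.le
    linarith

theorem tendsto_tailOne (ha : 0 < a) (b : ℝ) : Tendsto (tailOne a b) atTop (𝓝 0) := by
  have hR := tendsto_inv_linear ha b
  have := ((tendsto_gauss ha b).mul ((((hR.pow 2).const_mul (3 * a)).const_add 1).add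
    ((hR.pow 4).const_mul (6 * a ^ 2)))).const_mul (2 / (9 * √a))
  simp only [zero_mul, mul_zero] at this
  exact this

theorem tendsto_tailTwo (ha : 0 < a) (b : ℝ) : Tendsto (tailTwo a b) atTop (𝓝 0) := by
  have hR := tendsto_inv_linear ha b
  have := ((tendsto_gauss ha b).mul (hR.add ((hR.pow 3).const_mul (2 * a)))).const_mul
    (2 / (9 * √a))
  simp only [zero_mul, mul_zero] at this
  exact this

theorem tendsto_tailThree (ha : 0 < a) (b : ℝ) : Tendsto (tailThree a b) atTop (𝓝 0) := by
  have := ((tendsto_gauss ha b).mul ((tendsto_inv_linear ha b).pow 2)).const_mul (2 / (9 * √a))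
  simp only [zero_mul, mul_zero] at this
  exact this

/-- Upper bounds for iterated integrals of `gauss ^ 2 / (a x + b) ^ 2`. -/
noncomputable def sqTail (n : ℕ) (a b x : ℝ) : ℝ :=
  gauss a b x ^ 2 * (a * x + b)⁻¹ ^ (n + 1)

/-- Differentiating gauss² produces the factor -2(a x + b), so a tail integration gains 1/2 and one
power of (a x + b)⁻¹; the other term has a favourable sign. -/
theorem exists_hasDerivAt_sqTail (ha : 0 < a) (n : ℕ) {x : ℝ} (hx : 0 < a * x + b) :
    ∃ k, HasDerivAt (sqTail (n + 1) a b) (-k) x ∧ 2 * sqTail n a b x ≤ k := by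
  have e := mul_inv_cancel₀ hx.ne'
  have hR0 : 0 < (a * x + b)⁻¹ := inv_pos.2 hx
  refine ⟨_, (((hasDerivAt_gauss ha b x).pow 2).mul
    ((hasDerivAt_inv_linear hx).pow (n + 2))).congr_deriv
    (g' := -(2 * sqTail n a b x
      + (n + 2) * a * (gauss a b x ^ 2 * (a * x + b)⁻¹ ^ (n + 3)))) ?_, ?_⟩
  · simp only [Pi.pow_apply, sqTail]
    generalize (a * x + b)⁻¹ = R at *
    push_cast
    linear_combination (-2 * gauss a b x ^ 2 * R ^ (n + 1)) * e
  · have := gauss_pos a b x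
    have : 0 ≤ (n + 2) * a * (gauss a b x ^ 2 * (a * x + b)⁻¹ ^ (n + 3)) := by positivity
    linarith

theorem tendsto_sqTail (ha : 0 < a) (b : ℝ) (n : ℕ) : Tendsto (sqTail n a b) atTop (𝓝 0) := by
  have := ((tendsto_gauss ha b).pow 2).mul ((tendsto_inv_linear ha b).pow (n + 1))
  rw [zero_pow two_ne_zero, zero_mul] at this
  exact this

end Tails

/-! ### The error of the approximation on `[5 / 2, ∞)` -/

namespace IsAsymptotic

variable {F p u G : ℝ → ℝ} {a b C : ℝ}

theorem hasDerivWithinAt_slope (hf : IsFlow F p u) (a : ℝ) {y x : ℝ} (hy : 0 ≤ y) (hx : y ≤ x) :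
    HasDerivWithinAt (fun x => a - p x) (-u x) (Ici y) x :=
  ((hf.hp x (hy.trans hx)).mono (Ici_subset_Ici.2 hy)).const_sub a

theorem hasDerivWithinAt_sub (hf : IsFlow F p u) (a b : ℝ) {y x : ℝ} (hy : 0 ≤ y) (hx : y ≤ x) :
    HasDerivWithinAt (fun x => F x - (a * x + b)) (-(a - p x)) (Ici y) x := by
  refine (((hf.hF x (hy.trans hx)).mono (Ici_subset_Ici.2 hy)).sub
    (((hasDerivAt_id x).const_mul a).add_const b).hasDerivWithinAt).congr_deriv ?_
  ring

theorem tendsto_slope (h : IsAsymptotic F p u G a b C) :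
    Tendsto (fun x => a - p x) atTop (𝓝 0) := by
  simpa using h.tendsto_p.const_sub a

theorem u_pos (h : IsAsymptotic F p u G a b C) (hC : 0 < C) {x : ℝ} (hx : 0 ≤ x) : 0 < u x := by
  rw [h.hu x hx]; positivity

theorem u_eq (h : IsAsymptotic F p u G a b C) {x : ℝ} (hx : 0 ≤ x) :
    u x = C * gauss a b x * Real.exp (G x) := by
  rw [h.hu x hx, Real.exp_add, gauss, mul_assoc]

theorem sub_nonneg (h : IsAsymptotic F p u G a b C) (hf : IsFlow F p u) (hC : 0 < C) {x : ℝ}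
    (hx : 0 ≤ x) : 0 ≤ F x - (a * x + b) :=
  tail_nonneg (fun _ hy => hasDerivWithinAt_sub hf a b le_rfl hy)
    (fun _ hy => tail_nonneg (fun _ hy => hasDerivWithinAt_slope hf a le_rfl hy)
      (fun _ hz => (h.u_pos hC hz).le) h.tendsto_slope hy) h.tendsto_F hx

theorem antitone_G (h : IsAsymptotic F p u G a b C) (hf : IsFlow F p u) (hC : 0 < C) :
    AntitoneOn G (Ici 0) :=
  antitoneOn_Ici_of_hasDerivWithinAt h.hG fun _ hx => neg_nonpos.2 (h.sub_nonneg hf hC hx)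

theorem G_nonneg (h : IsAsymptotic F p u G a b C) (hf : IsFlow F p u) (hC : 0 < C) {x : ℝ}
    (hx : 0 ≤ x) : 0 ≤ G x :=
  tail_nonneg h.hG (fun _ hy => h.sub_nonneg hf hC hy) h.tendsto_G hx

theorem sub_le (h : IsAsymptotic F p u G a b C) (hf : IsFlow F p u) (hC : 0 < C) (ha : 0 < a)
    {x : ℝ} (hx : 0 ≤ x) (hL : 0 < a * x + b) :
    F x - (a * x + b) ≤ Real.exp (G x) * C * tailTwo a b x := by
  have hK : 0 < Real.exp (G x) * C := by positivity
  have key : ∀ y, ∃ k, x ≤ y → HasDerivAt (tailOne a b) (-k) y ∧ gauss a b y ≤ k := fun y => by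
    by_cases hy : x ≤ y
    · obtain ⟨k, hk⟩ := exists_hasDerivAt_tailOne ha (pos_of_le ha hL hy)
      exact ⟨k, fun _ => hk⟩
    · exact ⟨0, fun h => absurd h hy⟩
  choose k hk using key
  have h1 : ∀ y, x ≤ y → a - p y ≤ Real.exp (G x) * C * tailOne a b y := by
    intro y hy
    refine tail_le (x₀ := x) (fun _ hz => hasDerivWithinAt_slope hf a hx hz)
      (B := fun y => Real.exp (G x) * C * tailOne a b y)
      (κ := fun y => Real.exp (G x) * C * k y) (fun z hz => ?_) (fun z hz => ?_)
      h.tendsto_slope ?_ hy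
    · rw [← mul_neg]
      exact ((hk z hz).1.const_mul _).hasDerivWithinAt
    · have e1 := Real.exp_le_exp.2 (h.antitone_G hf hC hx (hx.trans hz) hz)
      rw [h.u_eq (hx.trans hz)]
      have e2 := mul_le_mul_of_nonneg_left (hk z hz).2 hK.le
      have e3 := mul_le_mul_of_nonneg_left e1 (mul_pos hC (gauss_pos a b z)).le
      linarith
    · simpa using (tendsto_tailOne ha b).const_mul (Real.exp (G x) * C)
  refine tail_le (x₀ := x) (fun _ hz => hasDerivWithinAt_sub hf a b hx hz)
    (B := fun y => Real.exp (G x) * C * tailTwo a b y)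
    (κ := fun y => Real.exp (G x) * C * tailOne a b y) (fun z hz => ?_) h1
    h.tendsto_F ?_ le_rfl
  · rw [← mul_neg]
    exact ((hasDerivAt_tailTwo ha (pos_of_le ha hL hz)).const_mul _).hasDerivWithinAt
  · simpa using (tendsto_tailTwo ha b).const_mul (Real.exp (G x) * C)

/-- Working with exp(-G) instead of G cancels the factor exp(G) of `sub_le`, so the estimate needs
no prior bound on G. -/
theorem one_sub_exp_le (h : IsAsymptotic F p u G a b C) (hf : IsFlow F p u) (hC : 0 < C)
    (ha : 0 < a) {x : ℝ} (hx : 0 ≤ x) (hL : 0 < a * x + b) :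
    1 - Real.exp (-G x) ≤ C * tailThree a b x := by
  refine tail_le (x₀ := x) (f := fun x => 1 - Real.exp (-G x))
    (k := fun y => (F y - (a * y + b)) * Real.exp (-G y)) (B := fun y => C * tailThree a b y)
    (κ := fun y => C * tailTwo a b y) (fun z hz => ?_) (fun z hz => ?_) (fun z hz => ?_) ?_ ?_ le_rfl
  · refine ((((h.hG z (hx.trans hz)).mono (Ici_subset_Ici.2 hx)).neg.exp).const_sub 1).congr_deriv ?_
    simp only [Pi.neg_apply]
    ring
  · rw [← mul_neg]
    exact ((hasDerivAt_tailThree ha (pos_of_le ha hL hz)).const_mul _).hasDerivWithinAt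
  · have e1 := h.sub_le hf hC ha (hx.trans hz) (pos_of_le ha hL hz)
    have e2 := mul_le_mul_of_nonneg_right e1 (Real.exp_pos (-G z)).le
    have e3 : Real.exp (G z) * Real.exp (-G z) = 1 := by rw [← Real.exp_add]; simp
    calc _ ≤ _ := e2
      _ = Real.exp (G z) * Real.exp (-G z) * (C * tailTwo a b z) := by ring
      _ = _ := by rw [e3, one_mul]
  · have := (h.tendsto_G.neg.rexp).const_sub 1
    simpa using this
  · simpa using (tendsto_tailThree ha b).const_mul C

/-- From exp(G) - 1 = exp(G)(1 - exp(-G)), and 1/(1 - 0.0026) < 1.0027. -/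
theorem exp_sub_one_le (h : IsAsymptotic F p u G a b C) (hf : IsFlow F p u) (hC : 0 < C)
    (ha : 0 < a) {x : ℝ} (hx : 0 ≤ x) (hL : 0 < a * x + b)
    (hT : C * tailThree a b x ≤ 0.0026) :
    Real.exp (G x) - 1 ≤ 1.0027 * (C * tailThree a b x) := by
  have h1 := h.one_sub_exp_le hf hC ha hx hL
  have e3 : Real.exp (G x) * Real.exp (-G x) = 1 := by rw [← Real.exp_add]; simp
  have hE := Real.exp_pos (G x)
  have h2 : Real.exp (G x) - 1 ≤ Real.exp (G x) * (C * tailThree a b x) := by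
    nlinarith
  have h3 : 0 ≤ C * tailThree a b x := by
    have := gauss_pos a b x
    unfold tailThree
    positivity
  have h4 : Real.exp (G x) ≤ 1.0027 := by nlinarith
  nlinarith

/-- With z = exp(y) - 1, the inequality log(1 + z) ≥ 2z/(z + 2) gives z - y ≤ z²/(z + 2). -/
theorem exp_sub_one_sub_le {y : ℝ} (hy : 0 ≤ y) :
    Real.exp y - 1 - y ≤ (Real.exp y - 1) ^ 2 / 2 := by
  have hz : 0 ≤ Real.exp y - 1 := by linarith [Real.add_one_le_exp y]
  have h := Real.le_log_one_add_of_nonneg hz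
  rw [add_sub_cancel, Real.log_exp, div_le_iff₀ (by linarith)] at h
  nlinarith [mul_nonneg hz (mul_nonneg hz hz)]

section Difference

variable {c x₀ x : ℝ}

/-- G and c `tailTerm` are threefold tail integrals of u and of C g, and u = C g exp(G) ≥ C g. -/
theorem sub_tailTerm_nonneg (h : IsAsymptotic F p u G a b (c * a * √(2 * a)))
    (hf : IsFlow F p u) (hC : 0 < c * a * √(2 * a)) (ha : 0 < a) (hx₀ : 0 ≤ x₀)
    (hx : x₀ ≤ x) :
    0 ≤ G x - c * tailTerm (sigma a b x) := by
  have lim1 : Tendsto (fun y => a - p y - c * a * (√Real.pi * erfc (sigma a b y))) atTop (𝓝 0) := by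
    have := h.tendsto_slope.sub
      (((tendsto_erfc.comp (tendsto_sigma ha b)).const_mul √Real.pi).const_mul (c * a))
    simpa using this
  have lim2 : Tendsto (fun y => F y - (a * y + b) - c * √(2 * a) * firstTerm (sigma a b y))
      atTop (𝓝 0) := by
    have := h.tendsto_F.sub
      ((tendsto_firstTerm.comp (tendsto_sigma ha b)).const_mul (c * √(2 * a)))
    simpa using this
  have lim3 : Tendsto (fun y => G y - c * tailTerm (sigma a b y)) atTop (𝓝 0) := by
    simpa using h.tendsto_G.sub (tendsto_tailTerm_sigma ha b c)
  have hle : ∀ y, x₀ ≤ y → 0 ≤ y := fun y hy => hx₀.trans hy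
  refine tail_nonneg (x₀ := x₀)
    (k := fun y => F y - (a * y + b) - c * √(2 * a) * firstTerm (sigma a b y))
    (fun y hy => ?_) (fun y hy => ?_) lim3 hx
  · refine (((h.hG y (hle y hy)).mono (Ici_subset_Ici.2 hx₀)).sub
      (hasDerivAt_tailTerm_sigma ha b c y).hasDerivWithinAt).congr_deriv ?_
    ring
  refine tail_nonneg (x₀ := x₀)
    (k := fun y => a - p y - c * a * (√Real.pi * erfc (sigma a b y)))
    (fun y hy => ?_) (fun y hy => ?_) lim2 hy
  · refine ((hasDerivWithinAt_sub hf a b hx₀ hy).sub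
      (hasDerivAt_firstTerm_sigma ha b c y).hasDerivWithinAt).congr_deriv ?_
    ring
  refine tail_nonneg (x₀ := x₀) (k := fun y => u y - c * a * √(2 * a) * gauss a b y)
    (fun y hy => ?_) (fun y hy => ?_) lim1 hy
  · refine ((hasDerivWithinAt_slope hf a hx₀ hy).sub
      (hasDerivAt_erfc_sigma ha b c y).hasDerivWithinAt).congr_deriv ?_
    rw [gauss]
    ring
  · rw [h.u_eq (hle y hy)]
    have h1 := Real.add_one_le_exp (G y)
    have h2 := h.G_nonneg hf hC (hle y hy)
    have h3 := mul_pos hC (gauss_pos a b y)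
    nlinarith

/-- The threefold tail integral now has integrand C g (exp(G) - 1) ≤ K g² (a x + b)⁻². Each
integration through `sqTail` halves the constant, which gives K/8. -/
theorem sub_tailTerm_le (h : IsAsymptotic F p u G a b (c * a * √(2 * a)))
    (hf : IsFlow F p u) (hC : 0 < c * a * √(2 * a)) (ha : 0 < a) (hx₀ : 0 ≤ x₀)
    (hL : 0 < a * x₀ + b)
    (hT : ∀ x, x₀ ≤ x → c * a * √(2 * a) * tailThree a b x ≤ 0.0026) (hx : x₀ ≤ x) :
    G x - c * tailTerm (sigma a b x)
      ≤ 1.0027 * (c * a * √(2 * a)) ^ 2 * (2 / (9 * √a)) / 8 * sqTail 4 a b x := by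
  set C := c * a * √(2 * a) with hCdef
  set K := 1.0027 * C ^ 2 * (2 / (9 * √a)) with hK
  have hK0 : 0 ≤ K := by positivity
  have lim1 : Tendsto (fun y => a - p y - c * a * (√Real.pi * erfc (sigma a b y))) atTop (𝓝 0) := by
    have := h.tendsto_slope.sub
      (((tendsto_erfc.comp (tendsto_sigma ha b)).const_mul √Real.pi).const_mul (c * a))
    simpa using this
  have lim2 : Tendsto (fun y => F y - (a * y + b) - c * √(2 * a) * firstTerm (sigma a b y))
      atTop (𝓝 0) := by
    have := h.tendsto_F.sub
      ((tendsto_firstTerm.comp (tendsto_sigma ha b)).const_mul (c * √(2 * a)))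
    simpa using this
  have lim3 : Tendsto (fun y => G y - c * tailTerm (sigma a b y)) atTop (𝓝 0) := by
    simpa using h.tendsto_G.sub (tendsto_tailTerm_sigma ha b c)
  have limT : ∀ (k : ℝ) (n : ℕ), Tendsto (fun y => k * sqTail n a b y) atTop (𝓝 0) := fun k n => by
    simpa using (tendsto_sqTail ha b n).const_mul k
  have hle : ∀ y, x₀ ≤ y → 0 ≤ y := fun y hy => hx₀.trans hy
  have key : ∀ n y, ∃ k, x₀ ≤ y →
      HasDerivAt (sqTail (n + 1) a b) (-k) y ∧ 2 * sqTail n a b y ≤ k := fun n y => by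
    by_cases hy : x₀ ≤ y
    · obtain ⟨k, hk⟩ := exists_hasDerivAt_sqTail ha n (pos_of_le ha hL hy)
      exact ⟨k, fun _ => hk⟩
    · exact ⟨0, fun h => absurd h hy⟩
  choose k hk using key
  have dT : ∀ (m : ℝ) (n : ℕ) (y : ℝ), x₀ ≤ y →
      HasDerivWithinAt (fun y => m * sqTail (n + 1) a b y) (-(m * k n y)) (Ici x₀) y :=
    fun m n y hy => by
      rw [← mul_neg]
      exact ((hk n y hy).1.const_mul m).hasDerivWithinAt
  refine tail_le (x₀ := x₀)
    (k := fun y => F y - (a * y + b) - c * √(2 * a) * firstTerm (sigma a b y))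
    (fun y hy => ?_) (dT (K / 8) 3) (fun y hy => ?_) lim3 (limT _ _) hx
  · refine (((h.hG y (hle y hy)).mono (Ici_subset_Ici.2 hx₀)).sub
      (hasDerivAt_tailTerm_sigma ha b c y).hasDerivWithinAt).congr_deriv ?_
    ring
  refine le_trans ?_ (show K / 4 * sqTail 3 a b y ≤ K / 8 * k 3 y by
    nlinarith [mul_le_mul_of_nonneg_left (hk 3 y hy).2 hK0])
  refine tail_le (x₀ := x₀)
    (k := fun y => a - p y - c * a * (√Real.pi * erfc (sigma a b y)))
    (fun y hy => ?_) (dT (K / 4) 2) (fun y hy => ?_) lim2 (limT _ _) hy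
  · refine ((hasDerivWithinAt_sub hf a b hx₀ hy).sub
      (hasDerivAt_firstTerm_sigma ha b c y).hasDerivWithinAt).congr_deriv ?_
    ring
  refine le_trans ?_ (show K / 2 * sqTail 2 a b y ≤ K / 4 * k 2 y by
    nlinarith [mul_le_mul_of_nonneg_left (hk 2 y hy).2 hK0])
  refine tail_le (x₀ := x₀) (k := fun y => u y - C * gauss a b y)
    (fun y hy => ?_) (dT (K / 2) 1) (fun y hy => ?_) lim1 (limT _ _) hy
  · refine ((hasDerivWithinAt_slope hf a hx₀ hy).sub
      (hasDerivAt_erfc_sigma ha b c y).hasDerivWithinAt).congr_deriv ?_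
    rw [gauss]
    ring
  refine le_trans ?_ (show K * sqTail 1 a b y ≤ K / 2 * k 1 y by
    nlinarith [mul_le_mul_of_nonneg_left (hk 1 y hy).2 hK0])
  have h1 := mul_le_mul_of_nonneg_left
    (h.exp_sub_one_le hf hC ha (hle y hy) (pos_of_le ha hL hy) (hT y hy))
    (mul_pos hC (gauss_pos a b y)).le
  rw [h.u_eq (hle y hy)]
  calc C * gauss a b y * Real.exp (G y) - C * gauss a b y
      = C * gauss a b y * (Real.exp (G y) - 1) := by ring
    _ ≤ _ := h1
    _ = _ := by rw [hK, sqTail, tailThree]; ring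

end Difference

end IsAsymptotic

/-- The numerical ranges of the parameters of the solution. -/
structure ParamRange (a b c : ℝ) : Prop where
  ha : 1.6551 ≤ a
  ha' : a ≤ 1.6553
  hc : 0.2336 ≤ c
  hc' : c ≤ 0.2338
  hL : 2.572 ≤ a * (5 / 2) + b

namespace ParamRange

variable {a b c x : ℝ}

theorem a_pos (h : ParamRange a b c) : 0 < a := by linarith [h.ha]

theorem linear_ge (h : ParamRange a b c) (hx : 5 / 2 ≤ x) : 2.572 ≤ a * x + b := by
  nlinarith [h.hL, h.a_pos]

theorem sqrt_le (h : ParamRange a b c) : √(2 * a) ≤ 1.8196 :=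
  Real.sqrt_le_iff.2 ⟨by norm_num, by linarith [h.ha']⟩

theorem le_sqrt (h : ParamRange a b c) : 1.8193 ≤ √(2 * a) :=
  Real.le_sqrt_of_sq_le (by linarith [h.ha])

theorem const_pos (h : ParamRange a b c) : 0 < c * a * √(2 * a) := by
  have h1 := h.le_sqrt
  have h2 := h.hc
  have h3 := h.ha
  have : 0 < c := by linarith
  have : 0 < a := by linarith
  positivity

theorem const_le (h : ParamRange a b c) : c * a * √(2 * a) ≤ 0.7043 := by
  have h1 := h.sqrt_le
  have h2 := h.hc'
  have h3 := h.ha'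
  have := h.a_pos
  calc c * a * √(2 * a) ≤ 0.2338 * 1.6553 * 1.8196 := by gcongr
    _ ≤ 0.7043 := by norm_num

theorem kappa_le (h : ParamRange a b c) : 2 / (9 * √a) ≤ 0.1728 := by
  have h1 : 1.2865 ≤ √a := Real.le_sqrt_of_sq_le (by linarith [h.ha])
  rw [div_le_iff₀ (by linarith)]
  linarith

theorem gauss_le (h : ParamRange a b c) (hx : 5 / 2 ≤ x) : gauss a b x ≤ 0.14 := by
  have hL := h.linear_ge hx
  have ha := h.a_pos
  have h1 : 1.998 ≤ (a * x + b) ^ 2 / (2 * a) := by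
    rw [le_div_iff₀ (by positivity)]
    have : (2.572 : ℝ) ^ 2 ≤ (a * x + b) ^ 2 := by gcongr
    linarith [h.ha']
  have h2 : gauss a b x ≤ Real.exp (-1.998) := Real.exp_le_exp.2 (by linarith)
  have h3 : (7.15 : ℝ) ≤ Real.exp 1.998 := by
    have e : Real.exp 1.998 = Real.exp 1 ^ 2 * Real.exp (-0.002) := by
      rw [← Real.exp_nat_mul, ← Real.exp_add]; norm_num
    have e1 := Real.exp_one_gt_d9
    have e2 := Real.add_one_le_exp (-0.002 : ℝ)
    have e3 : (2.718 : ℝ) ^ 2 ≤ Real.exp 1 ^ 2 := by gcongr; linarith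
    rw [e]
    calc (7.15 : ℝ) ≤ 2.718 ^ 2 * (-0.002 + 1) := by norm_num
      _ ≤ _ := by gcongr
  refine h2.trans ?_
  rw [Real.exp_neg, inv_le_comm₀ (Real.exp_pos _) (by norm_num)]
  exact le_trans (by norm_num) h3

theorem inv_le (h : ParamRange a b c) (hx : 5 / 2 ≤ x) :
    0 < (a * x + b)⁻¹ ∧ (a * x + b)⁻¹ ≤ 0.38881 := by
  have hL := h.linear_ge hx
  refine ⟨inv_pos.2 (by linarith), ?_⟩
  rw [inv_le_comm₀ (by linarith) (by norm_num)]
  exact le_trans (by norm_num) hL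

theorem tailThree_le (h : ParamRange a b c) (hx : 5 / 2 ≤ x) :
    c * a * √(2 * a) * tailThree a b x ≤ 0.0026 := by
  have h1 := h.const_le
  have h2 := h.kappa_le
  have h3 := h.gauss_le hx
  obtain ⟨h4, h5⟩ := h.inv_le hx
  have h6 := gauss_pos a b x
  unfold tailThree
  calc c * a * √(2 * a) * (2 / (9 * √a) * (gauss a b x * (a * x + b)⁻¹ ^ 2))
      ≤ 0.7043 * (0.1728 * (0.14 * 0.38881 ^ 2)) := by gcongr
    _ ≤ 0.0026 := by norm_num

/-- The error splits into the quadratic remainder of exp(G) and the defect of c `tailTerm` as an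
approximation of G. Both are nonnegative, so the absolute value disappears. -/
theorem abs_u_sub_le {F p u G : ℝ → ℝ} (h : ParamRange a b c)
    (hA : IsAsymptotic F p u G a b (c * a * √(2 * a))) (hf : IsFlow F p u) (hx : 5 / 2 ≤ x) :
    |u x - farDerivTwo a b c x|
      ≤ 5.02e-4 * (2 * a * (a * x + b)⁻¹ ^ 2) * gauss a b x ^ 3 := by
  have ha := h.a_pos
  have hC := h.const_pos
  have hx0 : 0 ≤ x := by linarith
  have hL0 : 0 < a * (5 / 2) + b := by linarith [h.hL]
  have hL := pos_of_le ha hL0 hx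
  have d0 := hA.sub_tailTerm_nonneg hf hC ha (by norm_num) hx
  have d1 := hA.sub_tailTerm_le hf hC ha (by norm_num) hL0 (fun y hy => h.tailThree_le hy) hx
  have g0 := hA.G_nonneg hf hC hx0
  have g1 := hA.exp_sub_one_le hf hC ha hx0 hL (h.tailThree_le hx)
  have g2 := IsAsymptotic.exp_sub_one_sub_le g0
  have g3 := Real.add_one_le_exp (G x)
  have c1 := h.const_le
  have c2 := h.kappa_le
  obtain ⟨r0, r1⟩ := h.inv_le hx
  have e0 := gauss_pos a b x
  have hκ : 0 < 2 / (9 * √a) := by positivity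
  have e : u x - farDerivTwo a b c x = c * a * √(2 * a) * gauss a b x *
      ((Real.exp (G x) - 1 - G x) + (G x - c * tailTerm (sigma a b x))) := by
    rw [hA.u_eq hx0, farDerivTwo, ← gauss]
    ring
  set H := c * tailTerm (sigma a b x)
  have z2 : (Real.exp (G x) - 1) ^ 2 ≤ (1.0027 * (c * a * √(2 * a) * tailThree a b x)) ^ 2 :=
    pow_le_pow_left₀ (by linarith) g1 2
  rw [e, abs_of_nonneg (mul_nonneg (by positivity) (by linarith))]
  set C := c * a * √(2 * a)
  set κ := 2 / (9 * √a) with hκdef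
  set R := (a * x + b)⁻¹ with hR
  set E := gauss a b x
  have s1 : Real.exp (G x) - 1 - G x + (G x - H)
      ≤ (1.0027 * (C * (κ * (E * R ^ 2)))) ^ 2 / 2 + 1.0027 * C ^ 2 * κ / 8 * (E ^ 2 * R ^ 5) := by
    have t1 : tailThree a b x = κ * (E * R ^ 2) := rfl
    have t2 : sqTail 4 a b x = E ^ 2 * R ^ 5 := rfl
    rw [t1] at z2
    rw [t2] at d1
    linarith
  calc C * E * (Real.exp (G x) - 1 - G x + (G x - H))
      ≤ C * E * ((1.0027 * (C * (κ * (E * R ^ 2)))) ^ 2 / 2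
        + 1.0027 * C ^ 2 * κ / 8 * (E ^ 2 * R ^ 5)) := by gcongr
    _ = C ^ 3 * κ * (1.0027 ^ 2 / 2 * κ * R ^ 2 + 1.0027 / 8 * R ^ 3) * R ^ 2 * E ^ 3 := by ring
    -- The factor R² is left unestimated, since 2a R² is the 1/t of the claim.
    _ ≤ 0.7043 ^ 3 * 0.1728 * (1.0027 ^ 2 / 2 * 0.1728 * 0.38881 ^ 2
        + 1.0027 / 8 * 0.38881 ^ 3) * R ^ 2 * E ^ 3 := by gcongr
    _ ≤ 5.02e-4 * (2 * 1.6551) * R ^ 2 * E ^ 3 := by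
      gcongr ?_ * R ^ 2 * E ^ 3
      norm_num
    _ ≤ 5.02e-4 * (2 * a * R ^ 2) * E ^ 3 := by
      have : 0 ≤ R ^ 2 * E ^ 3 := by positivity
      nlinarith [h.ha]

end ParamRange

section SigmaTails

variable {a b x : ℝ}

/-- The bounds of the error in terms of the square root of `tVar`. -/
noncomputable def sigmaTail (k : ℕ) (a b x : ℝ) : ℝ := (sigma a b x)⁻¹ ^ k * gauss a b x ^ 3

theorem sigma_pos (ha : 0 < a) (hx : 0 < a * x + b) : 0 < sigma a b x :=
  div_pos hx (Real.sqrt_pos.2 (by positivity))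

theorem sigmaTail_nonneg (k : ℕ) (ha : 0 < a) (hx : 0 < a * x + b) : 0 ≤ sigmaTail k a b x := by
  have := sigma_pos ha hx
  have := gauss_pos a b x
  unfold sigmaTail
  positivity

/-- A tail integration gains 1/(3√(2a)) and one power of σ⁻¹. With √(2a) ≥ 1.8193 this takes 5.02e-4
to 9.20e-5 and then to 1.69e-5. -/
theorem hasDerivAt_sigmaTail (k : ℕ) (ha : 0 < a) (hx : 0 < a * x + b) :
    HasDerivAt (sigmaTail (k + 1) a b) (-(√(2 * a) * (3 * sigmaTail k a b x
      + (k + 1) / 2 * sigmaTail (k + 2) a b x))) x := by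
  have hz := sigma_pos ha hx
  have hw : √(2 * a) ≠ 0 := (Real.sqrt_pos.2 (by positivity)).ne'
  refine ((((hasDerivAt_sigma ha b x).inv hz.ne').pow (k + 1)).mul
    ((hasDerivAt_gauss ha b x).pow 3)).congr_deriv ?_
  have e : a * x + b = sigma a b x * √(2 * a) := by rw [sigma, div_mul_cancel₀ _ hw]
  have e2 := mul_inv_cancel₀ hz.ne'
  simp only [Pi.pow_apply, Pi.inv_apply, sigmaTail]
  rw [e, neg_div, div_eq_mul_inv (√(2 * a) / 2), ← inv_pow]
  generalize (sigma a b x)⁻¹ = Z at *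
  push_cast
  linear_combination (-3 * √(2 * a) * gauss a b x ^ 3 * Z ^ k) * e2

theorem tendsto_sigmaTail (k : ℕ) (ha : 0 < a) (b : ℝ) :
    Tendsto (sigmaTail (k + 1) a b) atTop (𝓝 0) := by
  have := ((tendsto_sigma ha b).inv_tendsto_atTop.pow (k + 1)).mul ((tendsto_gauss ha b).pow 3)
  rw [zero_pow (Nat.succ_ne_zero k), zero_mul] at this
  exact this

theorem exp_neg_three_tVar (ha : 0 < a) (b x : ℝ) :
    Real.exp (-3 * tVar a b x) = gauss a b x ^ 3 := by
  rw [tVar_eq ha, sigma_sq ha, gauss, ← Real.exp_nat_mul]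
  push_cast
  ring_nf

theorem tVar_rpow (ha : 0 < a) (hx : 0 < a * x + b) (k : ℕ) {r : ℝ} (hr : r = -k / 2) :
    tVar a b x ^ r = (sigma a b x)⁻¹ ^ k := by
  have hz := sigma_pos ha hx
  rw [tVar_eq ha, hr, ← Real.rpow_natCast, ← Real.rpow_mul hz.le, inv_pow, ← Real.rpow_natCast,
    ← Real.rpow_neg hz.le]
  congr 1
  push_cast
  ring

theorem bound_eq_sigmaTail (ha : 0 < a) (hx : 0 < a * x + b) (k : ℕ) {r : ℝ} (hr : r = -k / 2)
    (K : ℝ) : K * tVar a b x ^ r * Real.exp (-3 * tVar a b x) = K * sigmaTail k a b x := by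
  rw [tVar_rpow ha hx k hr, exp_neg_three_tVar ha, sigmaTail, mul_assoc]

end SigmaTails

section FarError

variable {F p u : ℝ → ℝ} {a b c : ℝ}

theorem IsFlow.hasDerivWithinAt_sub_F₀far (hf : IsFlow F p u) (ha : 0 < a)
    (hL : 0 < a * (5 / 2) + b) (c : ℝ) {x : ℝ} (hx : 5 / 2 ≤ x) :
    HasDerivWithinAt (fun y => F y - F₀far a b c y) (p x - farDeriv a b c x) (Ici (5 / 2)) x :=
  ((hf.hF x (by linarith)).mono (Ici_subset_Ici.2 (by norm_num))).sub
    (hasDerivWithinAt_F₀far ha hL c hx)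

theorem IsFlow.hasDerivWithinAt_sub_farDeriv (hf : IsFlow F p u) (ha : 0 < a) (b c : ℝ) {x : ℝ}
    (hx : 5 / 2 ≤ x) :
    HasDerivWithinAt (fun y => p y - farDeriv a b c y) (u x - farDerivTwo a b c x)
      (Ici (5 / 2)) x :=
  ((hf.hp x (by linarith)).mono (Ici_subset_Ici.2 (by norm_num))).sub
    (hasDerivAt_farDeriv ha b c x).hasDerivWithinAt

theorem IsFlow.derivWithin_sub_F₀far (hf : IsFlow F p u) (ha : 0 < a)
    (hL : 0 < a * (5 / 2) + b) (c : ℝ) {x : ℝ} (hx : 5 / 2 ≤ x) :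
    derivWithin (fun y => F y - F₀far a b c y) (Ici (5 / 2)) x = p x - farDeriv a b c x :=
  (hf.hasDerivWithinAt_sub_F₀far ha hL c hx).derivWithin (uniqueDiffOn_Ici _ x hx)

theorem IsFlow.iteratedDerivWithin_sub_F₀far (hf : IsFlow F p u) (ha : 0 < a)
    (hL : 0 < a * (5 / 2) + b) (c : ℝ) {x : ℝ} (hx : 5 / 2 ≤ x) :
    iteratedDerivWithin 2 (fun y => F y - F₀far a b c y) (Ici (5 / 2)) x
      = u x - farDerivTwo a b c x :=
  iteratedDerivWithin_two_of_hasDerivWithinAt (uniqueDiffOn_Ici _)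
    (fun _ hy => hf.hasDerivWithinAt_sub_F₀far ha hL c hy)
    (fun _ hy => hf.hasDerivWithinAt_sub_farDeriv ha b c hy) hx

theorem ParamRange.errorBounds {G : ℝ → ℝ} (h : ParamRange a b c)
    (hA : IsAsymptotic F p u G a b (c * a * √(2 * a))) (hf : IsFlow F p u) (h1 : u 0 = 1) :
    ErrorBounds F a b c := by
  have ha := h.a_pos
  have hL0 : 0 < a * (5 / 2) + b := by linarith [h.hL]
  have hL : ∀ x, 5 / 2 ≤ x → 0 < a * x + b := fun x hx => pos_of_le ha hL0 hx
  have hw := h.le_sqrt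
  have b2 : ∀ x, 5 / 2 ≤ x → |u x - farDerivTwo a b c x| ≤ 5.02e-4 * sigmaTail 2 a b x := by
    intro x hx
    have e : sigmaTail 2 a b x = 2 * a * (a * x + b)⁻¹ ^ 2 * gauss a b x ^ 3 := by
      rw [sigmaTail, inv_pow, sigma_sq ha, inv_div, div_eq_mul_inv, inv_pow]
    rw [e, ← mul_assoc]
    exact h.abs_u_sub_le hA hf hx
  have lim : ∀ (K : ℝ) (k : ℕ), Tendsto (fun x => K * sigmaTail (k + 1) a b x) atTop (𝓝 0) :=
    fun K k => by simpa using (tendsto_sigmaTail k ha b).const_mul K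
  have b1 : ∀ x, 5 / 2 ≤ x → |p x - farDeriv a b c x| ≤ 9.20e-5 * sigmaTail 3 a b x := by
    intro x hx
    refine abs_tail_le (fun y hy => hf.hasDerivWithinAt_sub_farDeriv ha b c hy)
      (κ := fun x => 9.20e-5 * (√(2 * a) * (3 * sigmaTail 2 a b x
        + ((2 : ℕ) + 1) / 2 * sigmaTail (2 + 2) a b x)))
      (fun y hy => ?_) (fun y hy => (b2 y hy).trans ?_) ?_ (lim _ 2) hx
    · rw [← mul_neg]
      exact ((hasDerivAt_sigmaTail 2 ha (hL y hy)).const_mul _).hasDerivWithinAt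
    · have s2 := sigmaTail_nonneg 2 ha (hL y hy)
      have s4 := sigmaTail_nonneg (2 + 2) ha (hL y hy)
      have t1 := mul_le_mul_of_nonneg_right hw s2
      have t2 := mul_nonneg (Real.sqrt_nonneg (2 * a)) s4
      push_cast
      linarith
    · simpa using hA.tendsto_p.sub (tendsto_farDeriv ha b c)
  have b0 : ∀ x, 5 / 2 ≤ x → |F x - F₀far a b c x| ≤ 1.69e-5 * sigmaTail 4 a b x := by
    intro x hx
    refine abs_tail_le (fun y hy => hf.hasDerivWithinAt_sub_F₀far ha hL0 c hy)
      (κ := fun x => 1.69e-5 * (√(2 * a) * (3 * sigmaTail 3 a b x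
        + ((3 : ℕ) + 1) / 2 * sigmaTail (3 + 2) a b x)))
      (fun y hy => ?_) (fun y hy => (b1 y hy).trans ?_) ?_ (lim _ 3) hx
    · rw [← mul_neg]
      exact ((hasDerivAt_sigmaTail 3 ha (hL y hy)).const_mul _).hasDerivWithinAt
    · have s3 := sigmaTail_nonneg 3 ha (hL y hy)
      have s5 := sigmaTail_nonneg (3 + 2) ha (hL y hy)
      have t1 := mul_le_mul_of_nonneg_right hw s3
      have t2 := mul_nonneg (Real.sqrt_nonneg (2 * a)) s5
      push_cast
      linarith
    · have := hA.tendsto_F.sub (tendsto_F₀far_sub ha b c)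
      rw [sub_zero] at this
      exact this.congr fun y => by ring
  refine ⟨fun x hx => ?_, fun x hx => ?_, fun x hx => ?_, fun x hx => ?_, fun x hx => ?_,
    fun x hx => ?_⟩
  · exact (hf.near_bounds h1 a b c hx).1.trans (by norm_num)
  · exact (hf.near_bounds h1 a b c hx).2.1.trans (by norm_num)
  · exact (hf.near_bounds h1 a b c hx).2.2.trans (by norm_num)
  · rw [bound_eq_sigmaTail ha (hL x hx) 4 (by norm_num)]
    exact (b0 x hx).trans_eq (by norm_num)
  · rw [bound_eq_sigmaTail ha (hL x hx) 3 (by norm_num), hf.derivWithin_sub_F₀far ha hL0 c hx]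
    exact (b1 x hx).trans_eq (by norm_num)
  · rw [bound_eq_sigmaTail ha (hL x hx) 2 (by norm_num),
      hf.iteratedDerivWithin_sub_F₀far ha hL0 c hx]
    exact (b2 x hx).trans_eq (by norm_num)

/-! ### Uniqueness of the parameters -/

theorem eq_zero_of_tendsto_linear {α β : ℝ} (h : Tendsto (fun x => α * x + β) atTop (𝓝 0)) :
    α = 0 ∧ β = 0 := by
  have h1 := (h.comp (tendsto_atTop_add_const_right atTop (1 : ℝ) tendsto_id)).sub h
  have h2 : Tendsto (fun _ : ℝ => α) atTop (𝓝 (0 - 0)) := h1.congr fun x => by simp; ring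
  have hα : α = 0 := by simpa using tendsto_nhds_unique tendsto_const_nhds h2
  refine ⟨hα, ?_⟩
  simp only [hα, zero_mul, zero_add] at h
  exact tendsto_nhds_unique tendsto_const_nhds h

theorem mem_paramSet_iff {a b c : ℝ} : (a, b, c) ∈ paramSet ↔
    (a - 3221 / 1946) ^ 2 + 1 / 4 * (b + 2763 / 1765) ^ 2 + 1 / 4 * (c - 377 / 1613) ^ 2
      ≤ 25e-10 := by
  simp only [paramSet, mem_ofPred_eq]
  rw [Real.sqrt_le_left (by positivity)]
  norm_num

theorem bounds_of_mem_paramSet {a b c : ℝ} (h : (a, b, c) ∈ paramSet) :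
    0 < a ∧ 0 < a * (5 / 2) + b := by
  rw [mem_paramSet_iff] at h
  have h1 : |a - 3221 / 1946| ≤ 5e-5 :=
    abs_le_of_sq_le_sq (by nlinarith [sq_nonneg (b + 2763 / 1765), sq_nonneg (c - 377 / 1613)])
      (by norm_num)
  have h2 : |b + 2763 / 1765| ≤ 1e-4 :=
    abs_le_of_sq_le_sq (by nlinarith [sq_nonneg (a - 3221 / 1946), sq_nonneg (c - 377 / 1613)])
      (by norm_num)
  rw [abs_le] at h1 h2
  constructor <;> linarith

/-- The bound on E makes a' x + b' an asymptote of F, which fixes a' and b'. Dividing the bound on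
E'' by the Gaussian leaves an error tending to 0, so the Gaussian amplitudes C and c' a' √(2a')
agree. -/
theorem ErrorBounds.params_eq {G : ℝ → ℝ} {C : ℝ} (hf : IsFlow F p u)
    (hA : IsAsymptotic F p u G a b C) {a' b' c' : ℝ} (hmem : (a', b', c') ∈ paramSet)
    (hE : ErrorBounds F a' b' c') : a' = a ∧ b' = b ∧ c' * a' * √(2 * a') = C := by
  obtain ⟨ha', hL0⟩ := bounds_of_mem_paramSet hmem
  have hL : ∀ x, 5 / 2 ≤ x → 0 < a' * x + b' := fun x hx => pos_of_le ha' hL0 hx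
  have lim0 : Tendsto (fun x => F x - F₀far a' b' c' x) atTop (𝓝 0) := by
    have lim : Tendsto (fun x => 1.69 * 10 ^ (-5 : ℤ) * sigmaTail 4 a' b' x) atTop (𝓝 0) := by
      have := (tendsto_sigmaTail 3 ha' b').const_mul (1.69 * 10 ^ (-5 : ℤ))
      rwa [mul_zero] at this
    refine squeeze_zero_norm' ?_ lim
    filter_upwards [eventually_ge_atTop (5 / 2)] with x hx
    have := hE.far_zero x hx
    rwa [bound_eq_sigmaTail ha' (hL x hx) 4 (by norm_num)] at this
  have lim1 := (lim0.add (tendsto_F₀far_sub ha' b' c')).sub hA.tendsto_F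
  rw [add_zero, sub_zero] at lim1
  have lim2 : Tendsto (fun x => (a - a') * x + (b - b')) atTop (𝓝 0) :=
    lim1.congr fun x => by ring
  obtain ⟨e1, e2⟩ := eq_zero_of_tendsto_linear lim2
  obtain rfl : a = a' := sub_eq_zero.1 e1
  obtain rfl : b = b' := sub_eq_zero.1 e2
  refine ⟨rfl, rfl, ?_⟩
  have l1 : Tendsto (fun x => C * Real.exp (G x)) atTop (𝓝 (C * 1)) := by
    have := hA.tendsto_G.rexp.const_mul C
    rwa [Real.exp_zero] at this
  have l2 : Tendsto (fun x => c' * a * √(2 * a) * (1 + c' * tailTerm (sigma a b x))) atTop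
      (𝓝 (c' * a * √(2 * a) * (1 + 0))) :=
    ((tendsto_tailTerm_sigma ha' b c').const_add 1).const_mul _
  have l3 : Tendsto (fun x => C * Real.exp (G x)
      - c' * a * √(2 * a) * (1 + c' * tailTerm (sigma a b x))) atTop (𝓝 0) := by
    have lim : Tendsto (fun x => 5.02 * 10 ^ (-4 : ℤ) * ((sigma a b x)⁻¹ ^ 2 * gauss a b x ^ 2))
        atTop (𝓝 0) := by
      have := (((tendsto_sigma ha' b).inv_tendsto_atTop.pow 2).mul
        ((tendsto_gauss ha' b).pow 2)).const_mul (5.02 * 10 ^ (-4 : ℤ))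
      rw [zero_pow two_ne_zero, mul_zero, mul_zero] at this
      exact this
    refine squeeze_zero_norm' ?_ lim
    filter_upwards [eventually_ge_atTop (5 / 2)] with x hx
    have := hE.far_two x hx
    rw [bound_eq_sigmaTail ha' (hL x hx) 2 (by norm_num),
      hf.iteratedDerivWithin_sub_F₀far ha' hL0 c' hx, hA.u_eq (by linarith), farDerivTwo,
      ← gauss, sigmaTail] at this
    have hg := gauss_pos a b x
    have e : C * gauss a b x * Real.exp (G x)
        - c' * a * √(2 * a) * gauss a b x * (1 + c' * tailTerm (sigma a b x))
        = (C * Real.exp (G x) - c' * a * √(2 * a) * (1 + c' * tailTerm (sigma a b x)))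
          * gauss a b x := by ring
    rw [e, abs_mul, abs_of_pos hg] at this
    rw [Real.norm_eq_abs]
    refine le_of_mul_le_mul_right (this.trans_eq ?_) hg
    ring
  have := tendsto_nhds_unique l3 (l1.sub l2)
  linarith

end FarError

/-! ### The Blasius problem -/

namespace IsFlow

variable {F p u : ℝ → ℝ}

theorem scale (h : IsFlow F p u) {k : ℝ} (hk : 0 ≤ k) :
    IsFlow (fun x => k * F (k * x)) (fun x => k ^ 2 * p (k * x)) (fun x => k ^ 3 * u (k * x)) := by
  have hmap : MapsTo (fun x => k * x) (Ici (0 : ℝ)) (Ici 0) := fun x hx => mul_nonneg hk hx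
  have hlin : ∀ x, HasDerivWithinAt (fun x => k * x) (k * 1) (Ici 0) x := fun x =>
    ((hasDerivAt_id x).const_mul k).hasDerivWithinAt
  refine ⟨fun x hx => ?_, fun x hx => ?_, fun x hx => ?_, by simp [h.F_zero], by simp [h.p_zero]⟩
  · refine (((h.hF (k * x) (mul_nonneg hk hx)).comp x (hlin x) hmap).const_mul k).congr_deriv ?_
    ring
  · refine (((h.hp (k * x) (mul_nonneg hk hx)).comp x (hlin x) hmap).const_mul
      (k ^ 2)).congr_deriv ?_
    ring
  · refine (((h.hu (k * x) (mul_nonneg hk hx)).comp x (hlin x) hmap).const_mul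
      (k ^ 3)).congr_deriv ?_
    ring

/-- F'' keeps the sign of its initial value; were that nonpositive, F' would stay nonpositive and
could not tend to 1. -/
theorem pos_of_tendsto (h : IsFlow F p u) (hp : Tendsto p atTop (𝓝 1)) : 0 < u 0 := by
  by_contra hneg
  rw [not_lt] at hneg
  obtain ⟨S, -, -, hu⟩ := h.exists_integral
  have anti := antitoneOn_Ici_of_hasDerivWithinAt h.hp fun x hx => by
    rw [hu x hx]
    exact mul_nonpos_of_nonpos_of_nonneg hneg (Real.exp_pos _).le
  have : (1 : ℝ) ≤ 0 := le_of_tendsto hp <| (eventually_ge_atTop 0).mono fun x hx => by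
    simpa [h.p_zero] using anti self_mem_Ici hx hx
  linarith

/-- A flow whose first derivative tends to one is a rescaling of the solution of the initial
value problem. -/
theorem eq_scale {f q v : ℝ → ℝ} {a : ℝ} (h : IsFlow F p u) (h1 : u 0 = 1)
    (hp : Tendsto p atTop (𝓝 a)) (hf : IsFlow f q v) (hq : Tendsto q atTop (𝓝 1)) :
    (∀ x, 0 ≤ x → f x = (√a)⁻¹ * F ((√a)⁻¹ * x)) ∧ v 0 = (√a)⁻¹ ^ 3 := by
  have hv := hf.pos_of_tendsto hq
  -- This k normalises the second derivative at 0 to 1, so k f(k x) is the initial value solution;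
  -- comparing limits of first derivatives then gives k² = a.
  obtain ⟨k, hk, hk3⟩ : ∃ k : ℝ, 0 < k ∧ k ^ 3 * v 0 = 1 := by
    refine ⟨(v 0) ^ (-(1 : ℝ) / 3), by positivity, ?_⟩
    rw [← Real.rpow_natCast, ← Real.rpow_mul hv.le]
    norm_num [Real.rpow_neg_one, hv.ne']
  have hs := hf.scale hk.le
  have heq : ∀ x, 0 ≤ x → k * f (k * x) = F x := fun x hx =>
    h.eq_of_eq h1 hs (by simpa using hk3) hx
  have hpe : ∀ x, 0 ≤ x → k ^ 2 * q (k * x) = p x := fun x hx => by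
    rw [← h.derivWithin_eq hx, ← hs.derivWithin_eq hx]
    exact derivWithin_congr heq (heq x hx)
  have l1 : Tendsto (fun x => k ^ 2 * q (k * x)) atTop (𝓝 (k ^ 2 * 1)) :=
    (hq.comp (tendsto_id.const_mul_atTop hk)).const_mul (k ^ 2)
  have l2 : Tendsto p atTop (𝓝 (k ^ 2 * 1)) :=
    l1.congr' <| (eventually_ge_atTop 0).mono fun x hx => hpe x hx
  have hka : √a = k := by
    rw [tendsto_nhds_unique hp l2, mul_one, Real.sqrt_sq hk.le]
  rw [hka]
  refine ⟨fun x hx => ?_, ?_⟩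
  · rw [← heq (k⁻¹ * x) (by positivity), mul_inv_cancel_left₀ hk.ne', inv_mul_cancel_left₀ hk.ne']
  · rw [inv_pow]
    exact eq_inv_of_mul_eq_one_right hk3

end IsFlow

/-! ### Admissible parameters, wall stress and the final theorem -/

theorem exists_param :
    ∃ (F p u G : ℝ → ℝ) (a b c : ℝ), IsFlow F p u ∧ u 0 = 1 ∧
      IsAsymptotic F p u G a b (c * a * √(2 * a)) ∧ ParamRange a b c ∧ (a, b, c) ∈ paramSet ∧
      1.655184 ≤ a ∧ a ≤ 1.655194 := by
  obtain ⟨F, p, u, hf, h1⟩ := exists_isFlow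
  obtain ⟨G, a, b, C, hA, hC, ⟨a1, a2⟩, ⟨b1, b2⟩, c1, c2⟩ := hf.exists_asymptotic h1
  have ha : 0 < a := by linarith
  have hw : 0 < √(2 * a) := Real.sqrt_pos.2 (by positivity)
  -- The Gaussian amplitude of F'' must equal that of the second derivative of `F₀far`, which
  -- dictates c.
  obtain ⟨c, hc⟩ : ∃ c, C = c * a * √(2 * a) :=
    ⟨C / (a * √(2 * a)), by field_simp⟩
  have hc0 : 0 < c := by
    rw [hc, mul_assoc] at hC
    exact pos_of_mul_pos_left hC (by positivity)
  have hC2 : C ^ 2 = c ^ 2 * (2 * a ^ 3) := by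
    rw [hc, mul_pow, sqrt_two_mul_sq ha]; ring
  rw [hC2] at c1 c2
  have hk : 0 < 2 * a ^ 3 := by positivity
  have l1 := abs_le_of_sq_le_sq' (le_of_mul_le_mul_right c1 hk) hc0.le
  have l2 := abs_le_of_sq_le_sq' (le_of_mul_le_mul_right c2 hk) (by norm_num)
  refine ⟨F, p, u, G, a, b, c, hf, h1, hc ▸ hA, ⟨?_, ?_, ?_, ?_, ?_⟩, ?_, a1, a2⟩
  · linarith
  · linarith
  · linarith [l1.2]
  · linarith [l2.2]
  · linarith
  · rw [mem_paramSet_iff]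
    have r1 : (a - 3221 / 1946) ^ 2 ≤ 7e-6 ^ 2 := sq_le_sq' (by linarith) (by linarith)
    have r2 : (b + 2763 / 1765) ^ 2 ≤ 4e-5 ^ 2 := sq_le_sq' (by linarith) (by linarith)
    have r3 : (c - 377 / 1613) ^ 2 ≤ 6e-5 ^ 2 :=
      sq_le_sq' (by linarith [l1.2]) (by linarith [l2.2])
    -- The weighted sum of squares is at most 1.35e-9, below the allowed 2.5e-9.
    linarith

theorem wall_stress_bound {a : ℝ} (h1 : 1.655184 ≤ a) (h2 : a ≤ 1.655194) :
    |(√a)⁻¹ ^ 3 - 0.469600| ≤ 0.000022 := by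
  have ha : 0 < a := by linarith
  have hy : 0 < (√a)⁻¹ ^ 3 := by positivity
  have e : ((√a)⁻¹ ^ 3) ^ 2 * a ^ 3 = 1 := by
    rw [← pow_mul, inv_pow, show 3 * 2 = 2 * 3 by norm_num, pow_mul, Real.sq_sqrt ha.le]
    field_simp
  have k1 : (1.655184 : ℝ) ^ 3 ≤ a ^ 3 := by gcongr
  have k2 : a ^ 3 ≤ (1.655194 : ℝ) ^ 3 := by gcongr
  -- Only y² a³ = 1 and the range of a³ are needed from here on.
  generalize (√a)⁻¹ ^ 3 = y at *
  rw [abs_le]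
  constructor
  · by_contra hlt
    have : y ^ 2 ≤ 0.469578 ^ 2 := by gcongr; linarith
    nlinarith [sq_nonneg y]
  · by_contra hlt
    have : 0.469622 ^ 2 ≤ y ^ 2 := by gcongr; linarith
    nlinarith [sq_nonneg y]

theorem theorem1 :
    ∃ F : ℝ → ℝ, IsInitialValueSolution F ∧
      (∀ G : ℝ → ℝ, IsInitialValueSolution G → EqOn G F (Ici 0)) ∧
      (∃! p : ℝ × ℝ × ℝ, p ∈ paramSet ∧ ErrorBounds F p.1 p.2.1 p.2.2) ∧
      ∀ a b c : ℝ, (a, b, c) ∈ paramSet → ErrorBounds F a b c →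
        Tendsto (fun x => derivWithin F (Ici 0) x) atTop (𝓝 a) ∧
        IsBlasiusSolution (fun x => a ^ (-1 / 2 : ℝ) * F (a ^ (-1 / 2 : ℝ) * x)) ∧
        ∀ f : ℝ → ℝ, IsBlasiusSolution f →
          (∀ x ∈ Ici (0 : ℝ), f x = a ^ (-1 / 2 : ℝ) * F (a ^ (-1 / 2 : ℝ) * x)) ∧
          iteratedDerivWithin 2 f (Ici 0) 0 = a ^ (-3 / 2 : ℝ) ∧
          |iteratedDerivWithin 2 f (Ici 0) 0 - 0.469600| ≤ 0.000022 := by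
  obtain ⟨F, p, u, G, a, b, c, hf, h1, hA, hr, hmem, a1, a2⟩ := exists_param
  have ha : 0 < a := hr.a_pos
  have hB : ErrorBounds F a b c := hr.errorBounds hA hf h1
  -- Every admissible triple is the constructed one, so the remaining assertions can be proved for
  -- that triple alone.
  have huniq : ∀ a' b' c', (a', b', c') ∈ paramSet → ErrorBounds F a' b' c' →
      a' = a ∧ b' = b ∧ c' = c := fun a' b' c' hm hE => by
    obtain ⟨rfl, rfl, e⟩ := hE.params_eq hf hA hm
    have hw : √(2 * a') ≠ 0 := (Real.sqrt_pos.2 (by positivity)).ne'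
    exact ⟨rfl, rfl, mul_right_cancel₀ ha.ne' (mul_right_cancel₀ hw e)⟩
  have hroot : a ^ (-1 / 2 : ℝ) = (√a)⁻¹ := by
    rw [Real.sqrt_eq_rpow, ← Real.rpow_neg ha.le]
    norm_num
  have hroot3 : a ^ (-3 / 2 : ℝ) = (√a)⁻¹ ^ 3 := by
    rw [← hroot, ← Real.rpow_natCast, ← Real.rpow_mul ha.le]
    norm_num
  refine ⟨F, hf.isInitialValueSolution h1, fun G hG x hx => ?_, ⟨(a, b, c), ⟨hmem, hB⟩, ?_⟩, ?_⟩
  · exact hf.eq_of_eq h1 (IsFlow.of_contDiffOn hG.contDiffOn hG.ode hG.value_zero hG.deriv_zero)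
      hG.deriv_two_zero hx
  · rintro ⟨a', b', c'⟩ ⟨hm, hE⟩
    obtain ⟨rfl, rfl, rfl⟩ := huniq a' b' c' hm hE
    rfl
  · intro a' b' c' hm hE
    obtain ⟨rfl, rfl, rfl⟩ := huniq a' b' c' hm hE
    have hd : Tendsto (fun x => derivWithin F (Ici 0) x) atTop (𝓝 a') :=
      hA.tendsto_p.congr' <| (eventually_ge_atTop 0).mono fun x hx => (hf.derivWithin_eq hx).symm
    rw [hroot, hroot3]
    have hs : 0 < (√a')⁻¹ := inv_pos.2 (Real.sqrt_pos.2 ha)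
    refine ⟨hd, (hf.scale hs.le).isBlasiusSolution ?_, fun f hsol => ?_⟩
    · have := (hA.tendsto_p.comp (tendsto_id.const_mul_atTop hs)).const_mul ((√a')⁻¹ ^ 2)
      have e : (√a')⁻¹ ^ 2 * a' = 1 := by
        rw [inv_pow, Real.sq_sqrt ha.le, inv_mul_cancel₀ ha.ne']
      rw [e] at this
      exact this
    · have hfl := IsFlow.of_contDiffOn hsol.contDiffOn hsol.ode hsol.value_zero hsol.deriv_zero
      obtain ⟨e1, e2⟩ := hf.eq_scale h1 hA.tendsto_p hfl hsol.deriv_tendsto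
      exact ⟨fun x hx => e1 x hx, e2, e2 ▸ wall_stress_bound a1 a2⟩
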